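/- **Setting.** Let $(V,Y,\mathbf 1,\omega)$ be a vertex operator algebra over $\mathbb C$, with $Y(v,z)=\sum_{n\in\mathbb Z}v_nz^{-n-1}$, $L(n)=\omega_{n+1}$, and $V=\bigoplus_{n\in\mathbb Z}V_n$, where $V_n=\{v : L(0)v=nv\}$ is the space of homogeneous vectors of weight $n$ ($\operatorname{wt}v=n$). Let $g$ be an automorphism of $V$ of finite order $T$, and for $0\le r\le T-1$ let $V^r=\{v\in V : gv=e^{2\pi i r/T}v\}$. For homogeneous $u\in V^r$ and $v\in V$ put, with $\delta_r=1$ if $r=0$ and $\delta_r=0$ otherwise, $$u\circ_g v=\operatorname{Res}_z\frac{(1+z)^{\operatorname{wt}u-1+\delta_r+r/T}}{z^{1+\delta_r}}Y(u,z)v,\qquad u*_gv=\begin{cases}\operatorname{Res}_z\frac{(1+z)^{\operatorname{wt}u}}{z}Y(u,z)v & r=0,\\ 0 & r>0,\end{cases}$$ extend $*_g$ bilinearly to $V$, let $O_g(V)$ be the linear span of all $u\circ_gv$, and let $A_g(V)=V/O_g(V)$. The product $*_g$ makes $A_g(V)$ an associative algebra whose identity is the class of $\mathbf 1$. A weak $g$-twisted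 $V$-module is a complex vector space $M$ with a linear map $v\mapsto Y_M(v,z)=\sum_{n\in\mathbb Q}v_nz^{-n-1}$, $v_n\in\operatorname{End}M$, such that for all $0\le r\le T-1$, $u\in V^r$, $v\in V$, $w\in M$: $u_n=0$ unless $n\in\frac rT+\mathbb Z$; $v_nw=0$ for $n$ sufficiently large; $Y_M(\mathbf 1,z)=1$; and the twisted Jacobi identity holds: $$z_0^{-1}\delta\Big(\frac{z_1-z_2}{z_0}\Big)Y_M(u,z_1)Y_M(v,z_2)-z_0^{-1}\delta\Big(\frac{z_2-z_1}{-z_0}\Big)Y_M(v,z_2)Y_M(u,z_1)=z_2^{-1}\Big(\frac{z_1-z_0}{z_2}\Big)^{-r/T}\delta\Big(\frac{z_1-z_0}{z_2}\Big)Y_M(Y(u,z_0)v,z_2).$$ It is admissible if it carries a grading $M=\bigoplus_{n\in\frac1T\mathbb Z_{\ge0}}M(n)$ such that $v_mM(n)\subseteq M(n+\operatorname{wt}v-m-1)$ for all homogeneous $v\in V$, and all $m,n$ (with $M(q)=0$ for $q\notin\frac1T\mathbb Z_{\ge 0}$). An admissible module $M$ is simple if $M\neq0$ and its only graded submodules are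 $0$ and $M$. Let $$\Omega(M)=\{w\in M : a_mw=0\text{ for all homogeneous }a\in V\text{ and all }m\in\mathbb Q\text{ with }\operatorname{wt}a-m-1<0\}.$$ **Proposition.** Let $M$ be a simple admissible $g$-twisted $V$-module, with the grading shifted so that $M(0)\ne0$. Then (i) $\Omega(M)=M(0)$; (ii) $\Omega(M)$ is a simple $A_g(V)$-module, where the class in $A_g(V)$ of a homogeneous vector $a\in V^0$ acts as $o(a)=a_{\operatorname{wt}a-1}$. -/

import Mathlib

open scoped DirectSum

noncomputable section

/-- A vertex operator algebra `(V, Y, 𝟏, ω)` over `ℂ`, with `Y(u, z) = ∑ₙ uₙ z⁻ⁿ⁻¹`; here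
`Y u n` is the mode `uₙ`. The operators `L(n) = ωₙ₊₁` are the modes of the conformal vector, and
the homogeneous space `V_n` is the eigenspace of `L(0)` for the eigenvalue `n`. -/
structure VertexOperatorAlgebra (V : Type*) [AddCommGroup V] [Module ℂ V] where
  /-- the modes `uₙ` of the vertex operators `Y(u, z)` -/
  Y : V →ₗ[ℂ] (ℤ → Module.End ℂ V)
  /-- the vacuum vector `𝟏` -/
  vac : V
  /-- the conformal (Virasoro) vector `ω` -/
  omega : V
  /-- the rank (central charge) -/
  rank : ℂ
  /-- `uₙ v = 0` for `n` sufficiently large -/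
  truncation : ∀ u v : V, ∃ N : ℤ, ∀ n : ℤ, N ≤ n → Y u n v = 0
  /-- `Y(𝟏, z) = 1` -/
  vacuum : ∀ n : ℤ, Y vac n = if n = -1 then 1 else 0
  /-- `Y(u, z)𝟏` is a power series in `z` -/
  creation_regular : ∀ (u : V) (n : ℤ), 0 ≤ n → Y u n vac = 0
  /-- the constant term of `Y(u, z)𝟏` is `u` -/
  creation : ∀ u : V, Y u (-1) vac = u
  /-- The Jacobi identity: the coefficient of `z₀⁻ˡ⁻¹ z₁⁻ᵐ⁻¹ z₂⁻ⁿ⁻¹`, applied to `w`. All sums are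
  finite by truncation. -/
  jacobi : ∀ (u v w : V) (l m n : ℤ),
    (∑ᶠ i : ℕ, ((-1 : ℂ) ^ i * ((Ring.choose l i : ℤ) : ℂ)) •
        (Y u (l + m - i) (Y v (n + i) w) - (-1 : ℂ) ^ l • Y v (l + n - i) (Y u (m + i) w))) =
      ∑ᶠ i : ℕ, ((Ring.choose m i : ℤ) : ℂ) • Y (Y u (l + i) v) (m + n - i) w
  /-- the Virasoro relations for `L(n) = ωₙ₊₁` -/
  virasoro : ∀ m n : ℤ,
    Y omega (m + 1) * Y omega (n + 1) - Y omega (n + 1) * Y omega (m + 1) =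
      ((m : ℂ) - n) • Y omega (m + n + 1) +
        (if m + n = 0 then (1 / 12 : ℂ) * ((m : ℂ) ^ 3 - m) * rank else 0) •
          (1 : Module.End ℂ V)
  /-- `d/dz Y(v, z) = Y(L(-1)v, z)` -/
  derivative : ∀ (v : V) (n : ℤ), Y (Y omega 0 v) n = (-(n : ℂ)) • Y v (n - 1)
  /-- `V` is the direct sum of the eigenspaces `V_n` of `L(0)`, `n ∈ ℤ` -/
  grading : DirectSum.IsInternal fun n : ℤ => Module.End.eigenspace (Y omega 1) (n : ℂ)
  /-- the homogeneous spaces are finite-dimensional -/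
  finite_dim : ∀ n : ℤ, FiniteDimensional ℂ (Module.End.eigenspace (Y omega 1) (n : ℂ))
  /-- `V_n = 0` for `n` sufficiently small -/
  bounded_below : ∃ N : ℤ, ∀ n : ℤ, n < N → Module.End.eigenspace (Y omega 1) (n : ℂ) = ⊥

namespace VertexOperatorAlgebra

variable {V : Type*} [AddCommGroup V] [Module ℂ V]

/-- The space `V_n` of homogeneous vectors of weight `n`. -/
def weightSpace (A : VertexOperatorAlgebra V) (n : ℤ) : Submodule ℂ V :=
  Module.End.eigenspace (A.Y A.omega 1) (n : ℂ)

/-- `g` is an automorphism of the vertex operator algebra. -/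
structure IsAutomorphism (A : VertexOperatorAlgebra V) (g : V ≃ₗ[ℂ] V) : Prop where
  map_vac : g A.vac = A.vac
  map_omega : g A.omega = A.omega
  map_mode : ∀ (u v : V) (n : ℤ), g (A.Y u n v) = A.Y (g u) n (g v)

end VertexOperatorAlgebra

/-- The eigenspace `V^r = {v | g v = exp (2 π i r / T) v}`. -/
def twistEigenspace {V : Type*} [AddCommGroup V] [Module ℂ V] (T : ℕ) (g : V ≃ₗ[ℂ] V) (r : ℕ) :
    Submodule ℂ V :=
  Module.End.eigenspace (g : V →ₗ[ℂ] V)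
    (Complex.exp (2 * Real.pi * Complex.I * (r : ℂ) / (T : ℂ)))

section ZhuAlgebra

variable {V : Type*} [AddCommGroup V] [Module ℂ V]

/-- For `u ∈ V^r` homogeneous of weight `k`, and `δ = 1` if `r = 0`, `δ = 0` otherwise,
`u ∘_g v = Res_z (1 + z) ^ (k - 1 + δ + r / T) z ^ (-1 - δ) Y(u, z) v`. -/
def circProd (A : VertexOperatorAlgebra V) (T r : ℕ) (k : ℤ) (u v : V) : V :=
  let δ : ℤ := if r = 0 then 1 else 0
  ∑ᶠ i : ℕ, ((Ring.choose ((k : ℚ) - 1 + (δ : ℚ) + (r : ℚ) / (T : ℚ)) i : ℚ) : ℂ) •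
    A.Y u ((i : ℤ) - 1 - δ) v

/-- For `u ∈ V^r` homogeneous of weight `k`,
`u *_g v = Res_z (1 + z) ^ k z⁻¹ Y(u, z) v` if `r = 0`, and `u *_g v = 0` otherwise. -/
def starProd (A : VertexOperatorAlgebra V) (r : ℕ) (k : ℤ) (u v : V) : V :=
  if r = 0 then ∑ᶠ i : ℕ, ((Ring.choose k i : ℤ) : ℂ) • A.Y u ((i : ℤ) - 1) v else 0

/-- `O_g(V)`: the linear span of all `u ∘_g v` with `u ∈ V^r` homogeneous and `v ∈ V`. -/
def OgSubmodule (A : VertexOperatorAlgebra V) (T : ℕ) (g : V ≃ₗ[ℂ] V) : Submodule ℂ V :=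
  Submodule.span ℂ {x | ∃ (r : ℕ) (k : ℤ) (u v : V), r < T ∧ u ∈ twistEigenspace T g r ∧
    u ∈ A.weightSpace k ∧ x = circProd A T r k u v}

/-- The space `A_g(V) = V / O_g(V)`. -/
abbrev AgSpace (A : VertexOperatorAlgebra V) (T : ℕ) (g : V ≃ₗ[ℂ] V) : Type _ :=
  V ⧸ OgSubmodule A T g

/-- The associative unital algebra structure on `A_g(V) = V / O_g(V)` induced by the product
`*_g`. As `*_g` is the bilinear extension of its values on homogeneous eigenvectors of `g` in
the first argument, and these span `V`, there is at most one such structure. -/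
structure AgAlgebra (A : VertexOperatorAlgebra V) (T : ℕ) (g : V ≃ₗ[ℂ] V) where
  /-- the product of `A_g(V)` -/
  mul : AgSpace A T g →ₗ[ℂ] AgSpace A T g →ₗ[ℂ] AgSpace A T g
  /-- the product is induced by `*_g` -/
  mul_mk : ∀ (r : ℕ) (k : ℤ) (u v : V), r < T → u ∈ twistEigenspace T g r →
    u ∈ A.weightSpace k →
      mul (Submodule.Quotient.mk u) (Submodule.Quotient.mk v) =
        Submodule.Quotient.mk (starProd A r k u v)
  mul_assoc : ∀ a b c, mul (mul a b) c = mul a (mul b c)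
  /-- the class of the vacuum is a left identity -/
  vac_mul : ∀ a, mul (Submodule.Quotient.mk A.vac) a = a
  /-- the class of the vacuum is a right identity -/
  mul_vac : ∀ a, mul a (Submodule.Quotient.mk A.vac) = a

namespace AgAlgebra

variable {A : VertexOperatorAlgebra V} {T : ℕ} {g : V ≃ₗ[ℂ] V}

/-- The space `A_g(V)`, regarded as an algebra. -/
def Carrier (_S : AgAlgebra A T g) : Type _ := AgSpace A T g

/-- The class in `A_g(V)` of a vector of `V`. -/
def toClass (S : AgAlgebra A T g) (v : V) : S.Carrier := (Submodule.Quotient.mk v : AgSpace A T g)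

instance (S : AgAlgebra A T g) : AddCommGroup S.Carrier :=
  inferInstanceAs (AddCommGroup (AgSpace A T g))

instance (S : AgAlgebra A T g) : Module ℂ S.Carrier :=
  inferInstanceAs (Module ℂ (AgSpace A T g))

instance (S : AgAlgebra A T g) : Ring S.Carrier :=
  { (inferInstance : AddCommGroup S.Carrier) with
    mul := fun a b => S.mul a b
    one := S.toClass A.vac
    mul_assoc := S.mul_assoc
    one_mul := S.vac_mul
    mul_one := S.mul_vac
    left_distrib := fun a b c => (S.mul a).map_add b c
    right_distrib := fun a b c => S.mul.map_add₂ a b c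
    zero_mul := fun a => S.mul.map_zero₂ a
    mul_zero := fun a => (S.mul a).map_zero }

instance (S : AgAlgebra A T g) : Algebra ℂ S.Carrier :=
  Algebra.ofModule (fun c a b => S.mul.map_smul₂ c a b) (fun c a b => (S.mul a).map_smul c b)

end AgAlgebra

end ZhuAlgebra

/-- A weak `g`-twisted `V`-module structure on `M`: `Y_M(v, z) = ∑ vₙ z⁻ⁿ⁻¹` with `n ∈ ℚ`; here
`Y v n` is the mode `vₙ`. -/
structure WeakTwistedModule {V : Type*} [AddCommGroup V] [Module ℂ V]
    (A : VertexOperatorAlgebra V) (T : ℕ) (g : V ≃ₗ[ℂ] V)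
    (M : Type*) [AddCommGroup M] [Module ℂ M] where
  /-- the modes of the vertex operators on `M` -/
  Y : V →ₗ[ℂ] (ℚ → Module.End ℂ M)
  /-- for `u ∈ V^r`, only the modes `uₙ` with `n ∈ r / T + ℤ` occur -/
  mode_support : ∀ r : ℕ, r < T → ∀ u ∈ twistEigenspace T g r, ∀ n : ℚ,
    (¬ ∃ j : ℤ, n = (r : ℚ) / (T : ℚ) + j) → Y u n = 0
  /-- `vₙ w = 0` for `n` sufficiently large -/
  truncation : ∀ (v : V) (w : M), ∃ N : ℚ, ∀ n : ℚ, N ≤ n → Y v n w = 0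
  /-- `Y_M(𝟏, z) = 1` -/
  vacuum : ∀ n : ℚ, Y A.vac n = if n = -1 then 1 else 0
  /-- The twisted Jacobi identity for `u ∈ V^r`: the coefficient of `z₀⁻ˡ⁻¹ z₁⁻ᵐ⁻¹ z₂⁻ⁿ⁻¹`,
  applied to `w`. Both sides have no other powers of `z₁` than those with `m ∈ r / T + ℤ`. All
  sums are finite by truncation. -/
  jacobi : ∀ r : ℕ, r < T → ∀ u ∈ twistEigenspace T g r, ∀ (v : V) (w : M) (l : ℤ) (m n : ℚ),
    (∃ j : ℤ, m = (r : ℚ) / (T : ℚ) + j) →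
    (∑ᶠ i : ℕ, ((-1 : ℂ) ^ i * ((Ring.choose l i : ℤ) : ℂ)) •
        (Y u (l + m - i) (Y v (n + i) w) - (-1 : ℂ) ^ l • Y v (l + n - i) (Y u (m + i) w))) =
      ∑ᶠ i : ℕ, ((Ring.choose m i : ℚ) : ℂ) • Y (A.Y u (l + i) v) (m + n - i) w

/-- An admissible `g`-twisted `V`-module structure on `M`: a weak one with a grading
`M = ⨁ M(n)`, `n ∈ (1/T)ℤ₊`, such that `v_m M(n) ⊆ M(n + wt v - m - 1)` for homogeneous `v`. The
spaces `M(q)` with `q ∈ ℚ` outside `(1/T)ℤ₊` are zero. -/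
structure AdmissibleTwistedModule {V : Type*} [AddCommGroup V] [Module ℂ V]
    (A : VertexOperatorAlgebra V) (T : ℕ) (g : V ≃ₗ[ℂ] V)
    (M : Type*) [AddCommGroup M] [Module ℂ M] extends WeakTwistedModule A T g M where
  /-- the homogeneous space `M(n)` -/
  gr : ℚ → Submodule ℂ M
  gr_support : ∀ q : ℚ, (¬ ∃ j : ℕ, q = (j : ℚ) / (T : ℚ)) → gr q = ⊥
  gr_internal : DirectSum.IsInternal gr
  mode_gr : ∀ (k : ℤ), ∀ v ∈ A.weightSpace k, ∀ (m n : ℚ), ∀ w ∈ gr n,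
    Y v m w ∈ gr (n + k - m - 1)

section Modules

variable {V : Type*} [AddCommGroup V] [Module ℂ V] {A : VertexOperatorAlgebra V} {T : ℕ}
  {g : V ≃ₗ[ℂ] V} {M : Type*} [AddCommGroup M] [Module ℂ M]

/-- The space `Ω(M)` of lowest weight vectors: the vectors that are annihilated by `V[g]₋`, i.e.
by all modes `a_m` of negative degree `wt a - m - 1`, where `a ∈ V` is homogeneous. -/
def WeakTwistedModule.Omega (W : WeakTwistedModule A T g M) : Submodule ℂ M where
  carrier := {w | ∀ (k : ℤ), ∀ a ∈ A.weightSpace k, ∀ m : ℚ, (k : ℚ) - m - 1 < 0 → W.Y a m w = 0}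
  add_mem' := fun {x y} hx hy k a ha m hm => by
    rw [map_add, hx k a ha m hm, hy k a ha m hm, add_zero]
  zero_mem' := fun _ _ _ _ _ => map_zero _
  smul_mem' := fun c x hx k a ha m hm => by
    rw [map_smul, hx k a ha m hm, smul_zero]

/-- `N` is a graded submodule of the admissible `g`-twisted module. -/
structure AdmissibleTwistedModule.IsGradedSubmodule (W : AdmissibleTwistedModule A T g M)
    (N : Submodule ℂ M) : Prop where
  mode_mem : ∀ (v : V) (m : ℚ), ∀ w ∈ N, W.Y v m w ∈ N
  graded : N = ⨆ q : ℚ, N ⊓ W.gr q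

/-- A simple admissible `g`-twisted module: it is nonzero, and its only graded submodules are
`0` and itself. -/
def AdmissibleTwistedModule.IsSimple (W : AdmissibleTwistedModule A T g M) : Prop :=
  Nontrivial M ∧ ∀ N : Submodule ℂ M, W.IsGradedSubmodule N → N = ⊥ ∨ N = ⊤

end Modules

end

noncomputable section

open Finset

/-! Two facts about modules carry the result. First, for any `w` the span of the single modes `v_t
w` is stable under all modes (`mode_mode_mem_cyclicSpan`), so in a simple module it is everything as
soon as `w` is nonzero and homogeneous. Secondly, on `Ω(M)` the zero modes kill `O_g(V)` and turn
`*_g` into composition (`zeroMode_apply_of_mem_OgSubmodule`, `zeroMode_star`).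

Always `M(0) ⊆ Ω(M)`, because negative degrees are empty. Conversely, a nonzero component of a
vector of `Ω(M)` in degree `q > 0` again lies in `Ω(M)`, so it generates only degrees `≥ q`, yet it
generates `M`; this contradicts `M(0) ≠ 0`. For simplicity, take the degree-zero part of the span of
the `v_t w` with `0 ≠ w ∈ M(0)`: only zero modes contribute, so every vector of `M(0)` is some `o(v)
w`.

The algebra `A_g(V)` is itself to be constructed. The tool is the Jacobi identity paired with powers
of `1 + z₁`, `z₁`, `1 + z₂`, `z₂`, `z₁ - z₂` (`resMode_jacobi`): the commutator and iterate
formulas, read off from it, show that `O_g(V)` is a two-sided ideal and that `*_g` is associative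
modulo it. -/

theorem finsum_eq_sum_range {X : Type*} [AddCommMonoid X] {f : ℕ → X} {N : ℕ}
    (h : ∀ i, N ≤ i → f i = 0) : ∑ᶠ i, f i = ∑ i ∈ range N, f i := by
  refine finsum_eq_finsetSum_of_support_subset f fun i hi => ?_
  by_contra hn
  exact hi (h i (by simpa using hn))

/-! ### Binomial series with rational exponents -/

/-- The binomial coefficient `α.choose i` for rational `α`, as a complex number. -/
def binomC (α : ℚ) (i : ℕ) : ℂ := ((Ring.choose α i : ℚ) : ℂ)

theorem binomC_zero_right (α : ℚ) : binomC α 0 = 1 := by simp [binomC]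

theorem binomC_zero_left (i : ℕ) : binomC 0 i = if i = 0 then 1 else 0 := by
  rw [binomC, Ring.choose_zero_ite]; split_ifs <;> simp

theorem binomC_intCast (k : ℤ) (i : ℕ) : binomC k i = ((Ring.choose k i : ℤ) : ℂ) := by
  have := Ring.map_choose (Int.castRingHom ℚ) k i
  simp only [eq_intCast] at this
  rw [binomC, ← this]; simp

theorem binomC_natCast (k i : ℕ) : binomC k i = (k.choose i : ℂ) := by
  rw [binomC, Ring.choose_natCast]; simp

theorem binomC_succ (α : ℚ) (i : ℕ) :
    binomC (α + 1) (i + 1) = binomC α i + binomC α (i + 1) := by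
  simp [binomC, Ring.choose_succ_succ]

theorem binomC_add (α β : ℚ) (m : ℕ) :
    binomC (α + β) m = ∑ p ∈ antidiagonal m, binomC α p.1 * binomC β p.2 := by
  simp [binomC, Ring.add_choose_eq m (Commute.all α β)]

theorem binomC_mul_binomC (α : ℚ) (s t : ℕ) :
    binomC α (s + t) * binomC (s + t : ℕ) s = binomC α s * binomC (α - s) t := by
  have := Ring.choose_smul_choose α (n := s + t) (k := s) (by omega)
  rw [binomC_natCast]
  simp only [binomC]
  rw [← Rat.cast_mul]
  simp only [nsmul_eq_mul, Nat.add_sub_cancel_left] at this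
  rw [← this]
  push_cast
  ring

theorem succ_mul_binomC_succ (α : ℚ) (i : ℕ) :
    ((i : ℂ) + 1) * binomC α (i + 1) = α * binomC (α - 1) i := by
  have := binomC_mul_binomC α 1 i
  rw [add_comm 1 i, binomC_natCast] at this
  simp only [Nat.choose_one_right, binomC, Ring.choose_one_right] at this
  simp only [binomC]
  push_cast at this
  rw [← this]
  ring

/-- The coefficient of `zᵐ` in `(1 + z) ^ β · z ^ s · (d/dz) ^ s / s! (1 + z) ^ α`. -/
theorem sum_antidiagonal_binomC (α β : ℚ) (s m : ℕ) :
    ∑ p ∈ antidiagonal (s + m), binomC α p.1 * binomC β p.2 * binomC p.1 s =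
      binomC α s * binomC (α + β - s) m := by
  rw [show α + β - s = (α - s) + β by ring, binomC_add, mul_sum,
    Nat.sum_antidiagonal_eq_sum_range_succ_mk, Nat.sum_antidiagonal_eq_sum_range_succ_mk,
    show (s + m).succ = s + (m + 1) by omega, sum_range_add, sum_eq_zero, zero_add]
  · refine sum_congr rfl fun t _ => ?_
    rw [show s + m - (s + t) = m - t by omega, mul_right_comm, binomC_mul_binomC]
    ring
  · intro j hj
    rw [binomC_natCast j s, Nat.choose_eq_zero_of_lt (mem_range.1 hj)]
    simp

theorem sum_antidiagonal_binomC_of_lt (α β : ℚ) {s m : ℕ} (h : m < s) :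
    ∑ p ∈ antidiagonal m, binomC α p.1 * binomC β p.2 * binomC p.1 s = 0 := by
  refine sum_eq_zero fun p hp => ?_
  rw [binomC_natCast p.1 s, Nat.choose_eq_zero_of_lt, Nat.cast_zero, mul_zero]
  have := mem_antidiagonal.1 hp
  omega

/-- Since `y` vanishes from `N` on, the square of index pairs may be cut down to the triangle `j + k
< N` and summed along diagonals. -/
theorem sum_range_sum_range_eq_antidiagonal {X : Type*} [AddCommGroup X] [Module ℂ X]
    (c : ℕ → ℕ → ℂ) {y : ℕ → X} {N : ℕ} (hy : ∀ m, N ≤ m → y m = 0) :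
    ∑ j ∈ range N, ∑ k ∈ range N, c j k • y (j + k) =
      ∑ m ∈ range N, (∑ p ∈ antidiagonal m, c p.1 p.2) • y m := by
  have h1 : ∀ m ∈ range N, (∑ p ∈ antidiagonal m, c p.1 p.2) • y m =
      ∑ k ∈ range (m + 1), c k (m - k) • y (k + (m - k)) := by
    intro m _
    rw [Nat.sum_antidiagonal_eq_sum_range_succ_mk, sum_smul]
    refine sum_congr rfl fun k hk => ?_
    rw [mem_range] at hk
    congr 2
    omega
  rw [sum_congr rfl h1, sum_range_diag_flip N fun j k => c j k • y (j + k)]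
  refine sum_congr rfl fun j _ => ?_
  refine (sum_subset (range_subset_range.2 (Nat.sub_le N j)) fun k _ hk => ?_).symm
  rw [hy _ (by rw [mem_range] at hk; omega), smul_zero]

/-- The expansion of `(1 + z) ^ (α + β - s)` from the product of two binomial series. -/
theorem sum_binomC_mul_smul {X : Type*} [AddCommGroup X] [Module ℂ X] (α β : ℚ) (s : ℕ)
    {y : ℕ → X} {N : ℕ} (hy : ∀ m, N ≤ m → y m = 0) :
    ∑ j ∈ range N, ∑ k ∈ range N, (binomC α j * binomC β k * binomC j s) • y (j + k) =
      binomC α s • ∑ m ∈ range N, binomC (α + β - s) m • y (s + m) := by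
  rw [sum_range_sum_range_eq_antidiagonal (fun j k => binomC α j * binomC β k * binomC j s) hy]
  -- Lengthening the range to `s + N` costs nothing and lets the first `s` terms, which have zero
  -- coefficient, be split off.
  have h1 : ∀ f : ℕ → ℂ, ∑ m ∈ range N, f m • y m = ∑ m ∈ range (s + N), f m • y m := by
    intro f
    refine sum_subset (range_subset_range.2 (by omega)) fun k _ hk => ?_
    rw [hy _ (by rw [mem_range] at hk; omega), smul_zero]
  rw [h1, sum_range_add, sum_eq_zero, zero_add, smul_sum]
  · refine sum_congr rfl fun m _ => ?_
    rw [sum_antidiagonal_binomC, mul_smul]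
  · intro m hm
    rw [sum_antidiagonal_binomC_of_lt _ _ (mem_range.1 hm), zero_smul]

/-- Truncation of an iterated mode depends on the inner index `t`; but only the finitely many `t` in
`[p, K)` matter, so a maximum of the bounds serves for all. -/
theorem exists_uniform_truncation {X : Type*} [Zero X] (F : ℤ → ℤ → X) (p K : ℤ)
    (hK : ∀ t, K ≤ t → ∀ q, F t q = 0) (hF : ∀ t, ∃ Q, ∀ q, Q ≤ q → F t q = 0) :
    ∃ Q, ∀ q, Q ≤ q → ∀ t, p ≤ t → F t q = 0 := by
  choose Q hQ using hF
  obtain ⟨B, hB⟩ := ((Finset.Ico p K).image Q).bddAbove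
  refine ⟨B, fun q hq t ht => ?_⟩
  by_cases htK : K ≤ t
  · exact hK t htK q
  · refine hQ t q (le_trans (hB ?_) hq)
    simp only [coe_image, Set.mem_image, Finset.mem_coe, Finset.mem_Ico]
    exact ⟨t, ⟨ht, by omega⟩, rfl⟩

/-! ### Residues of vertex operators and the Jacobi identity for them -/

namespace VertexOperatorAlgebra

variable {V : Type*} [AddCommGroup V] [Module ℂ V] (A : VertexOperatorAlgebra V)

theorem exists_mode_eq_zero (n : ℤ) (u v : V) : ∃ N : ℕ, ∀ i : ℕ, N ≤ i → A.Y u (n + i) v = 0 := by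
  obtain ⟨K, hK⟩ := A.truncation u v
  exact ⟨(K - n).toNat, fun i hi => hK _ (by omega)⟩

theorem finite_support_mode (f : ℕ → ℂ) (n : ℤ) (u v : V) :
    (Function.support fun i : ℕ => f i • A.Y u (n + i) v).Finite := by
  obtain ⟨N, hN⟩ := A.exists_mode_eq_zero n u v
  refine (Set.finite_lt_nat N).subset fun i hi => ?_
  by_contra h
  exact hi (by simp [hN i (by simpa using h)])

/-- `Res_z (1 + z) ^ α z ^ n Y(u, z) v`. -/
def resMode (α : ℚ) (n : ℤ) : V →ₗ[ℂ] V →ₗ[ℂ] V :=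
  LinearMap.mk₂ ℂ (fun u v => ∑ᶠ i : ℕ, binomC α i • A.Y u (n + i) v)
    (fun u u' v => by
      rw [← finsum_add_distrib (A.finite_support_mode _ n u v) (A.finite_support_mode _ n u' v)]
      simp)
    (fun c u v => by
      rw [smul_finsum]
      simp [smul_comm c])
    (fun u v v' => by
      rw [← finsum_add_distrib (A.finite_support_mode _ n u v) (A.finite_support_mode _ n u v')]
      simp)
    (fun c u v => by
      rw [smul_finsum]
      simp [smul_comm c])

theorem resMode_apply (α : ℚ) (n : ℤ) (u v : V) :
    A.resMode α n u v = ∑ᶠ i : ℕ, binomC α i • A.Y u (n + i) v := rfl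

theorem resMode_eq_sum {α : ℚ} {n : ℤ} {u v : V} {N : ℕ}
    (h : ∀ i : ℕ, N ≤ i → A.Y u (n + i) v = 0) :
    A.resMode α n u v = ∑ i ∈ range N, binomC α i • A.Y u (n + i) v := by
  rw [resMode_apply, finsum_eq_sum_range fun i hi => by rw [h i hi, smul_zero]]

theorem jacobi_sum {u v w : V} {l m n : ℤ} {N : ℕ} (hv : ∀ i : ℕ, N ≤ i → A.Y v (n + i) w = 0)
    (hu : ∀ i : ℕ, N ≤ i → A.Y u (m + i) w = 0) (huv : ∀ i : ℕ, N ≤ i → A.Y u (l + i) v = 0) :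
    ∑ i ∈ range N, ((-1 : ℂ) ^ i * binomC l i) •
        (A.Y u (l + m - i) (A.Y v (n + i) w) -
          (-1 : ℂ) ^ l • A.Y v (l + n - i) (A.Y u (m + i) w)) =
      ∑ i ∈ range N, binomC m i • A.Y (A.Y u (l + i) v) (m + n - i) w := by
  have := A.jacobi u v w l m n
  simp only [← binomC_intCast] at this
  rwa [finsum_eq_sum_range fun i hi => by rw [hv i hi, hu i hi]; simp,
    finsum_eq_sum_range fun i hi => by rw [huv i hi]; simp] at this

theorem resMode_resMode_eq_sum (α β : ℚ) {q p : ℤ} {u v c : V} {N : ℕ}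
    (hv : ∀ k : ℕ, N ≤ k → A.Y v (p + k) c = 0)
    (h : ∀ j k : ℕ, N ≤ j → A.Y u (q + j) (A.Y v (p + k) c) = 0) :
    A.resMode α q u (A.resMode β p v c) = ∑ j ∈ range N, ∑ k ∈ range N,
      (binomC α j * binomC β k) • A.Y u (q + j) (A.Y v (p + k) c) := by
  rw [A.resMode_eq_sum hv, map_sum, sum_comm]
  refine sum_congr rfl fun k _ => ?_
  rw [map_smul, A.resMode_eq_sum fun j hj => h j k hj, smul_sum]
  refine sum_congr rfl fun j _ => ?_
  rw [smul_smul, mul_comm]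

/-- The Jacobi identity paired with `(1 + z₁) ^ α z₁ ^ n (1 + z₂) ^ β z₂ ^ p (z₁ - z₂) ^ l`. -/
theorem resMode_jacobi (α β : ℚ) (l n p : ℤ) (u v c : V) : ∃ N₀ : ℕ, ∀ N, N₀ ≤ N →
    ∑ i ∈ range N, ((-1 : ℂ) ^ i * binomC l i) •
        (A.resMode α (l + n - i) u (A.resMode β (p + i) v c) -
          (-1 : ℂ) ^ l • A.resMode β (l + p - i) v (A.resMode α (n + i) u c)) =
      ∑ i ∈ range N, ∑ s ∈ antidiagonal i, (binomC n s.2 * binomC α s.1) •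
        A.resMode (α + β - s.1) (n + p - s.2) (A.Y u (l + i) v) c := by
  obtain ⟨K₁, hK₁⟩ := A.truncation v c
  obtain ⟨K₂, hK₂⟩ := A.truncation u c
  obtain ⟨K₃, hK₃⟩ := A.truncation u v
  obtain ⟨M₁, hM₁⟩ := exists_uniform_truncation (fun t q => A.Y u q (A.Y v t c)) p K₁
    (fun t ht q => by simp [hK₁ t ht]) (fun t => A.truncation u _)
  obtain ⟨M₂, hM₂⟩ := exists_uniform_truncation (fun t q => A.Y v q (A.Y u t c)) n K₂
    (fun t ht q => by simp [hK₂ t ht]) (fun t => A.truncation v _)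
  obtain ⟨M₃, hM₃⟩ := exists_uniform_truncation (fun t q => A.Y (A.Y u t v) q c) l K₃
    (fun t ht q => by simp [hK₃ t ht]) (fun t => A.truncation _ c)
  -- A sum of natural numbers dominates each of them, so one cutoff makes every sum below finite
  -- with the same range.
  refine ⟨(K₁ - p).toNat + (K₂ - n).toNat + (K₃ - l).toNat + (M₁ - l - n).toNat +
    (M₂ - l - p).toNat + (M₃ - n - p).toNat, fun N hN => ?_⟩
  have hleft : ∀ i ∈ range N, ((-1 : ℂ) ^ i * binomC l i) •
        (A.resMode α (l + n - i) u (A.resMode β (p + i) v c) -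
          (-1 : ℂ) ^ l • A.resMode β (l + p - i) v (A.resMode α (n + i) u c)) =
      ∑ j ∈ range N, ∑ k ∈ range N, (binomC α j * binomC β k) • ((-1 : ℂ) ^ i * binomC l i) •
        (A.Y u (l + (n + j) - i) (A.Y v (p + k + i) c) -
          (-1 : ℂ) ^ l • A.Y v (l + (p + k) - i) (A.Y u (n + j + i) c)) := by
    intro i _
    rw [A.resMode_resMode_eq_sum (N := N) α β (fun k hk => hK₁ _ (by omega)) (fun j k hj => by
        by_cases hi : K₁ ≤ p + i + k
        · rw [hK₁ _ hi, map_zero]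
        · exact hM₁ _ (by omega) _ (by omega)),
      A.resMode_resMode_eq_sum (N := N) β α (fun k hk => hK₂ _ (by omega)) (fun j k hj => by
        by_cases hi : K₂ ≤ n + i + k
        · rw [hK₂ _ hi, map_zero]
        · exact hM₂ _ (by omega) _ (by omega)), sum_comm (s := range N) (t := range N)
        (f := fun j k => (binomC β j * binomC α k) • _), smul_sum, ← sum_sub_distrib, smul_sum]
    refine sum_congr rfl fun j _ => ?_
    rw [smul_sum, ← sum_sub_distrib, smul_sum]
    refine sum_congr rfl fun k _ => ?_
    rw [show l + (n + j) - i = l + n - (i : ℤ) + j by ring, show p + k + i = p + (i : ℤ) + k by ring,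
      show l + (p + k) - i = l + p - (i : ℤ) + k by ring, show n + j + i = n + (i : ℤ) + j by ring,
      mul_comm (binomC β k)]
    module
  rw [sum_congr rfl hleft, sum_comm]
  -- For fixed `j` and `k` the sum over `i` is the Jacobi identity with parameters `l`, `n + j`, `p
  -- + k`.
  have hmid : ∀ j ∈ range N, ∑ i ∈ range N, ∑ k ∈ range N,
      (binomC α j * binomC β k) • ((-1 : ℂ) ^ i * binomC l i) •
        (A.Y u (l + (n + j) - i) (A.Y v (p + k + i) c) -
          (-1 : ℂ) ^ l • A.Y v (l + (p + k) - i) (A.Y u (n + j + i) c)) =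
      ∑ i ∈ range N, ∑ k ∈ range N, (binomC α j * binomC β k) • binomC (n + j : ℤ) i •
        A.Y (A.Y u (l + i) v) (n + j + (p + k) - i) c := by
    intro j _
    rw [sum_comm]
    conv_rhs => rw [sum_comm]
    refine sum_congr rfl fun k _ => ?_
    rw [← smul_sum, ← smul_sum, A.jacobi_sum (fun i hi => hK₁ _ (by omega))
      (fun i hi => hK₂ _ (by omega)) (fun i hi => hK₃ _ (by omega))]
  rw [sum_congr rfl hmid]
  rw [sum_comm]
  refine sum_congr rfl fun i _ => ?_
  -- Vandermonde splits the coefficient of upper index `n + j`: the part in `j` differentiates `(1 +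
  -- z) ^ α`, the part in `n` differentiates `z ^ n`.
  have hexp : ∀ j ∈ range N, ∑ k ∈ range N, (binomC α j * binomC β k) • binomC (n + j : ℤ) i •
        A.Y (A.Y u (l + i) v) (n + j + (p + k) - i) c =
      ∑ s ∈ antidiagonal i, binomC n s.2 • ∑ k ∈ range N,
        (binomC α j * binomC β k * binomC j s.1) •
          A.Y (A.Y u (l + i) v) (n + p - i + (j + k : ℕ)) c := by
    intro j _
    simp only [smul_sum]
    rw [sum_comm]
    refine sum_congr rfl fun k _ => ?_
    rw [show ((n + j : ℤ) : ℚ) = (j : ℚ) + n by push_cast; ring, binomC_add, sum_smul, smul_sum]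
    refine sum_congr rfl fun s _ => ?_
    rw [show n + j + (p + k) - i = n + p - i + ((j + k : ℕ) : ℤ) by push_cast; ring]
    module
  rw [sum_congr rfl hexp, sum_comm]
  refine sum_congr rfl fun s hs => ?_
  rw [← smul_sum, sum_binomC_mul_smul α β s.1
    (y := fun m => A.Y (A.Y u (l + i) v) (n + p - i + (m : ℕ)) c), mul_smul,
    A.resMode_eq_sum (N := N)]
  · congr 2
    refine sum_congr rfl fun m _ => ?_
    have := mem_antidiagonal.1 hs
    rw [show n + p - i + ((s.1 + m : ℕ) : ℤ) = n + p - s.2 + m by push_cast; omega]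
  · intro m hm
    have := mem_antidiagonal.1 hs
    by_cases hi : K₃ ≤ l + i
    · rw [hK₃ _ hi]; simp
    · exact hM₃ _ (by omega) _ (by omega)
  · intro m hm
    by_cases hi : K₃ ≤ l + i
    · rw [hK₃ _ hi]; simp
    · exact hM₃ _ (by omega) _ (by omega)

end VertexOperatorAlgebra

/-! ### Eigenspace decomposition under an automorphism of finite order -/

section Twist

variable {V : Type*} [AddCommGroup V] [Module ℂ V] {T : ℕ} {g : V ≃ₗ[ℂ] V}

theorem mem_twistEigenspace {r : ℕ} {v : V} :
    v ∈ twistEigenspace T g r ↔ g v = Complex.exp (2 * Real.pi * Complex.I / T) ^ r • v := by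
  rw [twistEigenspace, Module.End.mem_eigenspace_iff, ← Complex.exp_nat_mul,
    show 2 * (Real.pi : ℂ) * Complex.I * r / T = r * (2 * Real.pi * Complex.I / T) by ring]
  rfl

theorem mem_twistEigenspace_zero {v : V} : v ∈ twistEigenspace T g 0 ↔ g v = v := by
  rw [mem_twistEigenspace, pow_zero, one_smul]

theorem twistEigenspace_mod (hT : 0 < T) (r : ℕ) :
    twistEigenspace T g (r % T) = twistEigenspace T g r := by
  ext v
  have h := (Complex.isPrimitiveRoot_exp T hT.ne').pow_eq_one
  rw [mem_twistEigenspace, mem_twistEigenspace]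
  conv_rhs => rw [← Nat.mod_add_div r T, pow_add, pow_mul, h, one_pow, mul_one]

/-- The projection of `V` onto `V^r`. -/
def twistProj (T : ℕ) (g : V ≃ₗ[ℂ] V) (r : ℕ) : V →ₗ[ℂ] V :=
  (T : ℂ)⁻¹ • ∑ i ∈ range T, ((Complex.exp (2 * Real.pi * Complex.I / T) ^ r)⁻¹) ^ i •
    ((g : V →ₗ[ℂ] V) : Module.End ℂ V) ^ i

theorem twistProj_apply (r : ℕ) (v : V) : twistProj T g r v =
    (T : ℂ)⁻¹ • ∑ i ∈ range T, ((Complex.exp (2 * Real.pi * Complex.I / T) ^ r)⁻¹) ^ i •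
      (((g : V →ₗ[ℂ] V) : Module.End ℂ V) ^ i) v := by
  simp [twistProj]

theorem pow_orderOf_toLinearMap (hord : orderOf g = T) (v : V) :
    (((g : V →ₗ[ℂ] V) : Module.End ℂ V) ^ T) v = v := by
  have h : g ^ T = 1 := hord ▸ pow_orderOf_eq_one g
  have h2 : ∀ n : ℕ, (((g : V →ₗ[ℂ] V) : Module.End ℂ V) ^ n) v = (g ^ n) v := by
    intro n
    induction n with
    | zero => rfl
    | succ n ih => rw [pow_succ', pow_succ', Module.End.mul_apply, ih]; rfl
  rw [h2, h]
  rfl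

theorem twistProj_mem (hT : 0 < T) (hord : orderOf g = T) (r : ℕ) (v : V) :
    twistProj T g r v ∈ twistEigenspace T g r := by
  have hz := (Complex.isPrimitiveRoot_exp T hT.ne').pow_eq_one
  rw [mem_twistEigenspace]
  set ζ := Complex.exp (2 * Real.pi * Complex.I / T)
  have hζ : ζ ^ r ≠ 0 := pow_ne_zero _ (Complex.exp_ne_zero _)
  have ha : ((ζ ^ r)⁻¹) ^ T = 1 := by rw [inv_pow, ← pow_mul, mul_comm, pow_mul, hz]; simp
  suffices h : (ζ ^ r)⁻¹ • g (twistProj T g r v) = twistProj T g r v by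
    conv_rhs => rw [← h]
    rw [smul_smul, mul_inv_cancel₀ hζ, one_smul]
  rw [twistProj_apply]
  simp only [map_smul, map_sum]
  rw [smul_comm, smul_sum]
  congr 1
  -- Cyclic shift: the sum over `0, …, T` is split at either end, and the two end terms agree
  -- because `g` and the root of unity both have `T`-th power one.
  have h1 := sum_range_succ (fun i => ((ζ ^ r)⁻¹) ^ i •
    (((g : V →ₗ[ℂ] V) : Module.End ℂ V) ^ i) v) T
  rw [sum_range_succ', ha, pow_orderOf_toLinearMap hord] at h1
  simp only [pow_zero, Module.End.one_apply, add_left_inj] at h1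
  rw [← h1]
  refine sum_congr rfl fun i _ => ?_
  rw [pow_succ', pow_succ', Module.End.mul_apply, smul_smul]
  rfl

theorem geom_sum_eq_ite {n : ℕ} {η : ℂ} (h : η ^ n = 1) [Decidable (η = 1)] :
    ∑ i ∈ range n, η ^ i = if η = 1 then (n : ℂ) else 0 := by
  split_ifs with h1
  · simp [h1]
  · have := mul_neg_geom_sum η n
    rw [h, sub_self] at this
    exact (mul_eq_zero.1 this).resolve_left (sub_ne_zero.2 (Ne.symm h1))

/-- Orthogonality of characters: summing over `r` first leaves only the term `i = 0`. -/
theorem sum_twistProj (hT : 0 < T) (v : V) : ∑ r ∈ range T, twistProj T g r v = v := by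
  classical
  have hp := Complex.isPrimitiveRoot_exp T hT.ne'
  have hz := hp.pow_eq_one
  simp only [twistProj_apply]
  set ζ := Complex.exp (2 * Real.pi * Complex.I / T)
  rw [← smul_sum, sum_comm]
  have h : ∀ i ∈ range T, ∑ r ∈ range T, ((ζ ^ r)⁻¹) ^ i •
      (((g : V →ₗ[ℂ] V) : Module.End ℂ V) ^ i) v = if i = 0 then (T : ℂ) • v else 0 := by
    intro i hi
    have h2 : ∀ r, ((ζ ^ r)⁻¹) ^ i = ((ζ ^ i)⁻¹) ^ r := fun r => by
      rw [inv_pow, inv_pow, ← pow_mul, ← pow_mul, mul_comm]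
    simp only [h2]
    rw [← sum_smul, geom_sum_eq_ite (by rw [inv_pow, ← pow_mul, mul_comm, pow_mul, hz]; simp)]
    by_cases h0 : i = 0
    · simp [h0]
    · rw [if_neg h0, if_neg, zero_smul]
      rw [inv_eq_one]
      exact hp.pow_ne_one_of_pos_of_lt h0 (mem_range.1 hi)
  rw [sum_congr rfl h]
  have : (T : ℂ) ≠ 0 := by exact_mod_cast hT.ne'
  simp [hT, smul_smul, this]

theorem pow_apply_of_mem_twistEigenspace {r : ℕ} {v : V} (hv : v ∈ twistEigenspace T g r)
    (i : ℕ) : (((g : V →ₗ[ℂ] V) : Module.End ℂ V) ^ i) v =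
      (Complex.exp (2 * Real.pi * Complex.I / T) ^ r) ^ i • v := by
  rw [mem_twistEigenspace] at hv
  induction i with
  | zero => simp
  | succ i ih => rw [pow_succ', Module.End.mul_apply, ih, map_smul, LinearEquiv.coe_coe, hv,
      smul_smul, ← pow_succ]

theorem twistProj_zero_apply (hT : 0 < T) {r : ℕ} (hr : r < T) {v : V}
    (hv : v ∈ twistEigenspace T g r) : twistProj T g 0 v = if r = 0 then v else 0 := by
  classical
  have hp := Complex.isPrimitiveRoot_exp T hT.ne'
  have hz := hp.pow_eq_one
  have hT' : (T : ℂ) ≠ 0 := by exact_mod_cast hT.ne'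
  rw [twistProj_apply]
  simp only [pow_zero, inv_one, one_pow, one_smul, pow_apply_of_mem_twistEigenspace hv]
  rw [← sum_smul, geom_sum_eq_ite (by rw [← pow_mul, mul_comm r, pow_mul, hz]; simp), smul_smul]
  by_cases h0 : r = 0
  · simp [h0, hT']
  · rw [if_neg h0, if_neg (hp.pow_ne_one_of_pos_of_lt h0 hr)]
    simp

end Twist

/-! ### Weights, homogeneous eigenvectors and the bilinear product on `V` -/

namespace VertexOperatorAlgebra

variable {V : Type*} [AddCommGroup V] [Module ℂ V] (A : VertexOperatorAlgebra V)

theorem mem_weightSpace {k : ℤ} {v : V} : v ∈ A.weightSpace k ↔ A.Y A.omega 1 v = (k : ℂ) • v :=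
  Module.End.mem_eigenspace_iff

theorem vac_mem_weightSpace : A.vac ∈ A.weightSpace 0 := by
  rw [mem_weightSpace, A.creation_regular _ _ zero_le_one]; simp

theorem mode_mem_weightSpace {k j : ℤ} {u v : V} (hu : u ∈ A.weightSpace k)
    (hv : v ∈ A.weightSpace j) (n : ℤ) : A.Y u n v ∈ A.weightSpace (k + j - n - 1) := by
  rw [mem_weightSpace] at *
  -- With `l = 0` and `m = 1` this is the commutator of `L(0)` with `u_n`; the right side has the
  -- two terms from `L(-1)u` and `L(0)u`.
  have h := A.jacobi A.omega u v 0 1 n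
  rw [finsum_eq_single _ 0 fun i hi => by
      rw [Ring.choose_zero_pos ℤ (Nat.pos_of_ne_zero hi)]; simp,
    finsum_eq_sum_range (N := 2) fun i hi => by
      have : Ring.choose (1 : ℤ) i = 0 := by
        have := Ring.choose_natCast (R := ℤ) 1 i
        rw [Nat.cast_one] at this
        rw [this, Nat.choose_eq_zero_of_lt (by omega), Nat.cast_zero]
      rw [this]; simp, sum_range_succ, sum_range_one] at h
  simp only [Ring.choose_zero_right, Ring.choose_one_right, Nat.cast_zero, Nat.cast_one,
    zero_add, add_zero, sub_zero, pow_zero, zpow_zero, Int.cast_one, mul_one, one_smul,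
    add_sub_cancel_left, hu, hv, map_smul, LinearMap.smul_apply, Pi.smul_apply, A.derivative,
    add_sub_cancel_left] at h
  rw [sub_eq_iff_eq_add] at h
  rw [h]
  push_cast
  module

theorem derivation_mem_weightSpace {k : ℤ} {u : V} (hu : u ∈ A.weightSpace k) :
    A.Y A.omega 0 u ∈ A.weightSpace (k + 1) := by
  -- The relation `[L(0), L(-1)] = L(-1)`.
  have h := congrArg (fun f : Module.End ℂ V => f u) (A.virasoro 0 (-1))
  rw [mem_weightSpace] at *
  simp at h
  rw [hu, sub_eq_iff_eq_add] at h
  rw [h, map_smul]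
  push_cast
  module

theorem mode_mem_twistEigenspace {g : V ≃ₗ[ℂ] V} (hg : A.IsAutomorphism g) {T r s : ℕ} {u v : V}
    (hu : u ∈ twistEigenspace T g r) (hv : v ∈ twistEigenspace T g s) (n : ℤ) :
    A.Y u n v ∈ twistEigenspace T g (r + s) := by
  rw [mem_twistEigenspace] at *
  rw [hg.map_mode, hu, hv]
  simp only [map_smul, LinearMap.smul_apply, Pi.smul_apply, smul_smul, pow_add]
  rw [mul_comm]

theorem vac_mem_twistEigenspace {g : V ≃ₗ[ℂ] V} (hg : A.IsAutomorphism g) (T : ℕ) :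
    A.vac ∈ twistEigenspace T g 0 :=
  mem_twistEigenspace_zero.2 hg.map_vac

theorem derivation_mem_twistEigenspace {g : V ≃ₗ[ℂ] V} (hg : A.IsAutomorphism g) {T r : ℕ} {u : V}
    (hu : u ∈ twistEigenspace T g r) : A.Y A.omega 0 u ∈ twistEigenspace T g r := by
  have := A.mode_mem_twistEigenspace hg (mem_twistEigenspace_zero.2 hg.map_omega) hu 0
  rwa [zero_add] at this

theorem twistProj_mem_weightSpace {g : V ≃ₗ[ℂ] V} (hg : A.IsAutomorphism g) (T r : ℕ) {k : ℤ}
    {u : V} (hu : u ∈ A.weightSpace k) : twistProj T g r u ∈ A.weightSpace k := by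
  have hg' : ∀ i : ℕ, (((g : V →ₗ[ℂ] V) : Module.End ℂ V) ^ i) u ∈ A.weightSpace k := by
    intro i
    induction i with
    | zero => exact hu
    | succ i ih =>
      rw [pow_succ', Module.End.mul_apply]
      rw [mem_weightSpace] at *
      have := hg.map_mode A.omega ((((g : V →ₗ[ℂ] V) : Module.End ℂ V) ^ i) u) 1
      rw [hg.map_omega, ih, map_smul] at this
      exact this.symm
  rw [twistProj_apply]
  exact Submodule.smul_mem _ _ (Submodule.sum_mem _ fun i _ => Submodule.smul_mem _ _ (hg' i))

theorem mem_of_weightSpace_le {N : Submodule ℂ V} (h : ∀ k, A.weightSpace k ≤ N) (v : V) :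
    v ∈ N := by
  have : (⊤ : Submodule ℂ V) ≤ N := by
    rw [← A.grading.submodule_iSup_eq_top]
    exact iSup_le h
  exact this trivial

/-- `V` is spanned by the homogeneous eigenvectors of `g`. -/
theorem mem_of_homogeneous {g : V ≃ₗ[ℂ] V} (hg : A.IsAutomorphism g) {T : ℕ} (hT : 0 < T)
    (hord : orderOf g = T) {N : Submodule ℂ V}
    (h : ∀ r < T, ∀ k, ∀ u ∈ twistEigenspace T g r, u ∈ A.weightSpace k → u ∈ N) (v : V) :
    v ∈ N := by
  refine A.mem_of_weightSpace_le (fun k u hu => ?_) v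
  rw [← sum_twistProj (g := g) hT u]
  exact Submodule.sum_mem _ fun r hr => h r (mem_range.1 hr) k _ (twistProj_mem hT hord r u)
    (A.twistProj_mem_weightSpace hg T r hu)

theorem bijective_coeLinearMap_weightSpace :
    Function.Bijective (DirectSum.coeLinearMap A.weightSpace) := A.grading

/-- The linear map on `V` given by `φ k` on the homogeneous vectors of weight `k`. -/
def weightwise {X : Type*} [AddCommGroup X] [Module ℂ X] (φ : ℤ → V →ₗ[ℂ] X) : V →ₗ[ℂ] X :=
  DirectSum.toModule ℂ ℤ X (fun k => φ k ∘ₗ (A.weightSpace k).subtype) ∘ₗ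
    ((LinearEquiv.ofBijective (DirectSum.coeLinearMap A.weightSpace)
      A.bijective_coeLinearMap_weightSpace).symm : V →ₗ[ℂ] _)

theorem weightwise_apply {X : Type*} [AddCommGroup X] [Module ℂ X] (φ : ℤ → V →ₗ[ℂ] X) {k : ℤ}
    {u : V} (hu : u ∈ A.weightSpace k) : A.weightwise φ u = φ k u := by
  have : (LinearEquiv.ofBijective (DirectSum.coeLinearMap A.weightSpace)
      A.bijective_coeLinearMap_weightSpace).symm u =
      DirectSum.lof ℂ ℤ (fun k => A.weightSpace k) k ⟨u, hu⟩ := by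
    rw [LinearEquiv.symm_apply_eq, LinearEquiv.ofBijective_apply, DirectSum.coeLinearMap_lof]
  rw [weightwise, LinearMap.comp_apply, LinearEquiv.coe_coe, this, DirectSum.toModule_lof]
  rfl

/-- The product `*_g` on `V`. -/
def star (T : ℕ) (g : V ≃ₗ[ℂ] V) : V →ₗ[ℂ] V →ₗ[ℂ] V :=
  A.weightwise (fun k => A.resMode k (-1)) ∘ₗ twistProj T g 0

theorem star_apply_zero {g : V ≃ₗ[ℂ] V} {T : ℕ} (hT : 0 < T) {k : ℤ} {u : V}
    (hu : u ∈ twistEigenspace T g 0) (hk : u ∈ A.weightSpace k) (v : V) :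
    A.star T g u v = A.resMode k (-1) u v := by
  rw [star, LinearMap.comp_apply, twistProj_zero_apply hT hT hu, if_pos rfl,
    A.weightwise_apply _ hk]

theorem star_apply_of_ne_zero {g : V ≃ₗ[ℂ] V} {T : ℕ} (hT : 0 < T) {r : ℕ} (hr : r < T)
    (h0 : r ≠ 0) {u : V} (hu : u ∈ twistEigenspace T g r) (v : V) : A.star T g u v = 0 := by
  rw [star, LinearMap.comp_apply, twistProj_zero_apply hT hr hu, if_neg h0, map_zero,
    LinearMap.zero_apply]

theorem star_eq_starProd {g : V ≃ₗ[ℂ] V} {T : ℕ} (hT : 0 < T) {r : ℕ} (hr : r < T) {k : ℤ} {u : V}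
    (hu : u ∈ twistEigenspace T g r) (hk : u ∈ A.weightSpace k) (v : V) :
    A.star T g u v = starProd A r k u v := by
  rw [starProd]
  split_ifs with h0
  · subst h0
    rw [A.star_apply_zero hT hu hk, resMode_apply]
    simp only [binomC_intCast]
    refine finsum_congr fun i => ?_
    rw [show (-1 : ℤ) + i = i - 1 by ring]
  · exact A.star_apply_of_ne_zero hT hr h0 hu v

end VertexOperatorAlgebra

/-! ### Changing the exponents in a residue -/

namespace VertexOperatorAlgebra

variable {V : Type*} [AddCommGroup V] [Module ℂ V] (A : VertexOperatorAlgebra V)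

theorem resMode_add_one (α : ℚ) (n : ℤ) (u v : V) :
    A.resMode (α + 1) n u v = A.resMode α n u v + A.resMode α (n + 1) u v := by
  obtain ⟨N, hN⟩ := A.exists_mode_eq_zero n u v
  rw [A.resMode_eq_sum (N := N + 1) fun i hi => hN i (by omega),
    A.resMode_eq_sum (N := N + 1) fun i hi => hN i (by omega),
    A.resMode_eq_sum (N := N) fun i hi => by
      have := hN (i + 1) (by omega)
      rwa [show n + ((i + 1 : ℕ) : ℤ) = n + 1 + i by push_cast; ring] at this,
    sum_range_succ', sum_range_succ', binomC_zero_right, binomC_zero_right, add_right_comm,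
    ← sum_add_distrib]
  congr 1
  refine sum_congr rfl fun i _ => ?_
  rw [show n + 1 + (i : ℤ) = n + ((i + 1 : ℕ) : ℤ) by push_cast; ring, binomC_succ]
  module

/-- Integration by parts for `Y(L(-1)u, z) = d/dz Y(u, z)`. -/
theorem resMode_derivation (β : ℚ) (p : ℤ) (u v : V) :
    A.resMode β p (A.Y A.omega 0 u) v =
      -(p : ℂ) • A.resMode β (p - 1) u v - (β : ℂ) • A.resMode (β - 1) p u v := by
  obtain ⟨N, hN⟩ := A.exists_mode_eq_zero (p - 1) u v
  have h2 : (β : ℂ) • A.resMode (β - 1) p u v =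
      ∑ i ∈ range (N + 1), ((i : ℂ) * binomC β i) • A.Y u (p - 1 + i) v := by
    rw [A.resMode_eq_sum (N := N) fun i hi => by
      have := hN (i + 1) (by omega)
      rwa [show p - 1 + ((i + 1 : ℕ) : ℤ) = p + i by push_cast; ring] at this,
      sum_range_succ', smul_sum]
    simp only [Nat.cast_zero, zero_mul, zero_smul, add_zero]
    refine sum_congr rfl fun i _ => ?_
    rw [show p - 1 + ((i + 1 : ℕ) : ℤ) = p + i by push_cast; ring, smul_smul,
      ← succ_mul_binomC_succ]
    push_cast
    rfl
  rw [h2, A.resMode_eq_sum (N := N + 1) fun i hi => hN i (by omega),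
    A.resMode_eq_sum (N := N + 1) fun i hi => by
      have := hN i (by omega)
      rw [A.derivative, show p + (i : ℤ) - 1 = p - 1 + i by ring, LinearMap.smul_apply, this,
        smul_zero], smul_sum, ← sum_sub_distrib]
  refine sum_congr rfl fun i _ => ?_
  rw [A.derivative, show p + (i : ℤ) - 1 = p - 1 + i by ring, LinearMap.smul_apply]
  push_cast
  module

end VertexOperatorAlgebra

/-! ### The ideal `O_g(V)` and the algebra `A_g(V)` -/

/-- `δ_r`. -/
def twistDelta (r : ℕ) : ℤ := if r = 0 then 1 else 0

/-- The exponent of `1 + z` in the definition of `u ∘_g v` for `u ∈ V^r` of weight `k`. -/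
def circExp (T r : ℕ) (k : ℤ) : ℚ := (k : ℚ) - 1 + (twistDelta r : ℚ) + (r : ℚ) / (T : ℚ)

theorem twistDelta_nonneg (r : ℕ) : 0 ≤ twistDelta r := by
  unfold twistDelta; split_ifs <;> simp

theorem circExp_zero (T : ℕ) (k : ℤ) : circExp T 0 k = k := by simp [circExp, twistDelta]

theorem circExp_add (T r : ℕ) (k j : ℤ) : circExp T r (k + j) = circExp T r k + j := by
  simp only [circExp]; push_cast; ring

/-- Either `r = s = 0`, or both are positive and `r / T + s / T = 1`. The second equation identifies
the exponent that the iterate formula forces on the second factor. -/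
theorem twistDelta_eq_and_circExp_of_mod_eq_zero {T r s : ℕ} (hr : r < T) (hs : s < T)
    (h : (r + s) % T = 0) (k j : ℤ) :
    twistDelta r = twistDelta s ∧
      ((k + j + twistDelta r : ℤ) : ℚ) - circExp T r k = circExp T s j + 1 := by
  rcases Nat.eq_zero_or_pos r with rfl | hr0
  · have : s = 0 := by simpa [Nat.mod_eq_of_lt hs] using h
    subst this
    refine ⟨rfl, ?_⟩
    simp [circExp, twistDelta]
    ring
  · have hT : r + s = T := by
      obtain ⟨c, hc⟩ := Nat.dvd_of_mod_eq_zero h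
      have : c = 1 := by
        have h1 : c < 2 := by by_contra h2; nlinarith
        have h0 : c ≠ 0 := by rintro rfl; omega
        omega
      rw [hc, this, mul_one]
    have hs0 : s ≠ 0 := by omega
    have hT0 : (T : ℚ) ≠ 0 := by exact_mod_cast (by omega : T ≠ 0)
    have hq : (r : ℚ) / T + (s : ℚ) / T = 1 := by
      rw [← add_div, ← Nat.cast_add, hT, div_self hT0]
    simp only [circExp, twistDelta, if_neg hr0.ne', if_neg hs0, true_and]
    push_cast
    linarith

namespace VertexOperatorAlgebra

variable {V : Type*} [AddCommGroup V] [Module ℂ V] (A : VertexOperatorAlgebra V)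

theorem circProd_eq_resMode (T r : ℕ) (k : ℤ) (u v : V) :
    circProd A T r k u v = A.resMode (circExp T r k) (-1 - twistDelta r) u v := by
  rw [resMode_apply]
  refine finsum_congr fun i => ?_
  rw [show -1 - twistDelta r + (i : ℤ) = i - 1 - twistDelta r by ring]
  rfl

variable {A} {T : ℕ} {g : V ≃ₗ[ℂ] V}

/-- Replacing `u` by `L(-1)u` raises the weight, hence the exponent of `1 + z`, by one. Integrating
by parts then lowers the power of `z`, modulo terms already known to lie in `O_g(V)`; the
coefficient `1 + δ_r + m` is invertible. -/
theorem resMode_mem_OgSubmodule_of_le_zero (hg : A.IsAutomorphism g) {r : ℕ} (hr : r < T) (v : V)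
    (m : ℕ) : ∀ {k : ℤ} {u : V}, u ∈ twistEigenspace T g r → u ∈ A.weightSpace k →
      A.resMode (circExp T r k) (-1 - twistDelta r - m) u v ∈ OgSubmodule A T g := by
  induction m with
  | zero =>
    intro k u hu hk
    refine Submodule.subset_span ⟨r, k, u, v, hr, hu, hk, ?_⟩
    rw [circProd_eq_resMode, Nat.cast_zero, sub_zero]
  | succ m ih =>
    intro k u hu hk
    have h1 := ih (A.derivation_mem_twistEigenspace hg hu) (A.derivation_mem_weightSpace hk)
    have h0 := ih hu hk
    rw [resMode_derivation, circExp_add, Int.cast_one, add_sub_cancel_right, A.resMode_add_one,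
      sub_add_cancel] at h1
    have h2 := Submodule.add_mem _ h1 (Submodule.smul_mem _ ((circExp T r k + 1 : ℚ) : ℂ) h0)
    rw [sub_add_cancel, smul_add] at h2
    have h3 := (Submodule.add_mem_iff_left _ (Submodule.smul_mem _ _ h0)).1 h2
    rw [Submodule.smul_mem_iff] at h3
    · rwa [Nat.cast_succ, ← sub_sub]
    · have := twistDelta_nonneg r
      rw [neg_ne_zero]
      exact_mod_cast (by omega : -1 - twistDelta r - (m : ℤ) ≠ 0)

/-- Expanding `(1 + z) ^ n z ^ (-m)` with `n ≤ m` gives only nonpositive powers of `z`. -/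
theorem resMode_mem_OgSubmodule (hg : A.IsAutomorphism g) {r : ℕ} (hr : r < T) {k : ℤ} {u : V}
    (hu : u ∈ twistEigenspace T g r) (hk : u ∈ A.weightSpace k) (v : V) (n : ℕ) :
    ∀ {m : ℕ}, n ≤ m → ∀ {α : ℚ} {p : ℤ}, α = circExp T r k + n → p = -1 - twistDelta r - m →
      A.resMode α p u v ∈ OgSubmodule A T g := by
  induction n with
  | zero =>
    rintro m - _ _ rfl rfl
    rw [Nat.cast_zero, add_zero]
    exact resMode_mem_OgSubmodule_of_le_zero hg hr v m hu hk
  | succ n ih =>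
    rintro m hm _ _ rfl rfl
    rw [Nat.cast_succ, ← add_assoc, A.resMode_add_one]
    exact Submodule.add_mem _ (ih (m := m) (by omega) rfl rfl)
      (ih (m := m - 1) (by omega) rfl (by omega))

/-- For `r ≠ 0` one has `δ_r = 0`, and `u ∘_g 𝟏 = u` by the creation property. -/
theorem mem_OgSubmodule_of_ne_zero {r : ℕ} (hr : r < T) (h0 : r ≠ 0) {k : ℤ} {u : V}
    (hu : u ∈ twistEigenspace T g r) (hk : u ∈ A.weightSpace k) : u ∈ OgSubmodule A T g := by
  refine Submodule.subset_span ⟨r, k, u, A.vac, hr, hu, hk, ?_⟩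
  rw [circProd_eq_resMode, A.resMode_eq_sum (N := 1) fun i hi => A.creation_regular _ _ (by
    rw [twistDelta, if_neg h0]; omega), sum_range_one, binomC_zero_right, one_smul, twistDelta,
    if_neg h0]
  exact (A.creation u).symm

/-- `O_g(V)` is spanned by the products `u ∘_g w` of homogeneous eigenvectors of `g`. -/
theorem apply_mem_of_mem_OgSubmodule {X : Type*} [AddCommGroup X] [Module ℂ X]
    (hg : A.IsAutomorphism g) (hT : 0 < T) (hord : orderOf g = T) (f : V →ₗ[ℂ] X)
    {N : Submodule ℂ X}
    (h : ∀ r < T, ∀ s < T, ∀ k j u w, u ∈ twistEigenspace T g r → u ∈ A.weightSpace k →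
      w ∈ twistEigenspace T g s → w ∈ A.weightSpace j →
        f (A.resMode (circExp T r k) (-1 - twistDelta r) u w) ∈ N) {x : V}
    (hx : x ∈ OgSubmodule A T g) : f x ∈ N := by
  have : OgSubmodule A T g ≤ N.comap f := by
    refine Submodule.span_le.2 ?_
    rintro _ ⟨r, k, u, v, hr, hu, hk, rfl⟩
    rw [circProd_eq_resMode]
    exact A.mem_of_homogeneous hg hT hord
      (N := (N.comap f).comap (A.resMode (circExp T r k) (-1 - twistDelta r) u))
      (fun s hs j w hw hj => h r hr s hs k j u w hu hk hw hj) v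
  exact this hx

/-- By the commutator formula, `a *_g (u ∘_g w)` is `u ∘_g (a *_g w)` plus residues of the vectors
`a_q u` against `w`. As `a` is fixed by `g`, these stay in `V^r`. -/
theorem star_mem_OgSubmodule_left (hg : A.IsAutomorphism g) (hT : 0 < T) (hord : orderOf g = T)
    (a : V) {x : V} (hx : x ∈ OgSubmodule A T g) : A.star T g a x ∈ OgSubmodule A T g := by
  refine apply_mem_of_mem_OgSubmodule hg hT hord (A.star T g a) ?_ hx
  intro r hr s hs k j u w hu hk _ _
  refine A.mem_of_homogeneous hg hT hord (N := (OgSubmodule A T g).comap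
    ((A.star T g).flip (A.resMode (circExp T r k) (-1 - twistDelta r) u w))) ?_ a
  intro t ht i a ha hi
  rw [Submodule.mem_comap, LinearMap.flip_apply]
  rcases eq_or_ne t 0 with rfl | ht0
  swap
  · rw [A.star_apply_of_ne_zero hT ht ht0 ha]
    exact Submodule.zero_mem _
  rw [A.star_apply_zero hT ha hi]
  obtain ⟨N, hN⟩ := A.resMode_jacobi i (circExp T r k) 0 (-1) (-1 - twistDelta r) a u w
  have h := hN (N + 1) (by omega)
  rw [sum_range_succ', sum_eq_zero (fun q _ => by
    rw [Int.cast_zero, binomC_zero_left, if_neg (Nat.succ_ne_zero q), mul_zero, zero_smul])] at h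
  simp only [Int.cast_zero, binomC_zero_right, pow_zero, mul_one, one_smul, zero_add, zpow_zero,
    Nat.cast_zero, sub_zero, add_zero, sub_eq_iff_eq_add] at h
  rw [h]
  refine Submodule.add_mem _ (Submodule.sum_mem _ fun q _ => Submodule.sum_mem _ fun y hy =>
    Submodule.smul_mem _ _ ?_) ?_
  · have hau : A.Y a q u ∈ twistEigenspace T g r := by
      have := A.mode_mem_twistEigenspace hg ha hu q
      rwa [zero_add] at this
    -- Relative to the weight of `a_q u`, there are `y.2 + 1` extra factors of both `1 + z` and
    -- `z⁻¹`.
    refine resMode_mem_OgSubmodule hg hr hau (A.mode_mem_weightSpace hi hk q) w (y.2 + 1)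
      (m := y.2 + 1) le_rfl ?_ ?_
    · rw [show i + k - (q : ℤ) - 1 = k + (i - q - 1) by ring, circExp_add, ← mem_antidiagonal.1 hy]
      push_cast
      ring
    · push_cast; ring
  · exact resMode_mem_OgSubmodule hg hr hu hk _ 0 (m := 0) le_rfl (by simp) (by simp)

/-- The iterate formula for the product of a residue with a third vector. -/
theorem star_resMode_eq_sum (hg : A.IsAutomorphism g) (hT : 0 < T) {r s : ℕ} {k j : ℤ} {u w : V}
    (hu : u ∈ twistEigenspace T g r) (hk : u ∈ A.weightSpace k) (hw : w ∈ twistEigenspace T g s)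
    (hj : w ∈ A.weightSpace j) (hrs : (r + s) % T = 0) (α : ℚ) (l : ℤ) {β : ℚ}
    (hβ : β = ((k + j - l - 1 : ℤ) : ℚ) - α) (c : V) : ∃ N₀ : ℕ, ∀ N, N₀ ≤ N →
      A.star T g (A.resMode α l u w) c = ∑ i ∈ range N, ((-1 : ℂ) ^ i * binomC l i) •
        (A.resMode α (l - i) u (A.resMode β (-1 + i) w c) -
          (-1 : ℂ) ^ l • A.resMode β (l - 1 - i) w (A.resMode α i u c)) := by
  obtain ⟨N₁, hN₁⟩ := A.resMode_jacobi α β l 0 (-1) u w c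
  obtain ⟨N₂, hN₂⟩ := A.exists_mode_eq_zero l u w
  refine ⟨N₁ + N₂, fun N hN => ?_⟩
  have h := hN₁ N (by omega)
  simp only [add_zero, zero_add, ← sub_eq_add_neg] at h
  rw [h, A.resMode_eq_sum (N := N) fun i hi => hN₂ i (by omega), map_sum, LinearMap.sum_apply]
  refine sum_congr rfl fun i _ => ?_
  have h1 : A.Y u (l + i) w ∈ twistEigenspace T g 0 := by
    rw [← hrs, twistEigenspace_mod hT]
    exact A.mode_mem_twistEigenspace hg hu hw _
  rw [map_smul, LinearMap.smul_apply, A.star_apply_zero hT h1 (A.mode_mem_weightSpace hk hj _),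
    -- Only `(i, 0)` survives because the power of `z₁` is zero. The choice of `β` makes `α + β - i`
    -- the weight of `u_{l+i} w`, as the product requires.
    sum_eq_single (i, 0)]
  · rw [Int.cast_zero, binomC_zero_right, one_mul, hβ]
    congr 4
    push_cast; ring
  · intro y hy hne
    rw [Int.cast_zero, binomC_zero_left, if_neg, zero_mul, zero_smul]
    intro h0
    refine hne (Prod.ext ?_ h0)
    have := mem_antidiagonal.1 hy
    simp only
    omega
  · intro hi
    exact (hi (mem_antidiagonal.2 (add_zero i))).elim

/-- If `r + s` is not divisible by `T`, the modes of `u ∘_g w` lie outside `V^0` and the product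
vanishes. Otherwise the iterate formula writes it as residues with `u` or `w` outermost, each with a
sufficiently negative power of `z`. -/
theorem star_mem_OgSubmodule_right (hg : A.IsAutomorphism g) (hT : 0 < T) (hord : orderOf g = T)
    {x : V} (hx : x ∈ OgSubmodule A T g) (c : V) : A.star T g x c ∈ OgSubmodule A T g := by
  refine apply_mem_of_mem_OgSubmodule hg hT hord ((A.star T g).flip c) ?_ hx
  intro r hr s hs k j u w hu hk hw hj
  rw [LinearMap.flip_apply]
  by_cases hrs : (r + s) % T = 0
  · obtain ⟨hδ, hβ⟩ := twistDelta_eq_and_circExp_of_mod_eq_zero hr hs hrs k j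
    obtain ⟨N, hN⟩ := star_resMode_eq_sum hg hT hu hk hw hj hrs (circExp T r k)
      (-1 - twistDelta r) (β := circExp T s j + 1) (by rw [← hβ]; push_cast; ring) c
    rw [hN N le_rfl]
    refine Submodule.sum_mem _ fun i _ => Submodule.smul_mem _ _ (Submodule.sub_mem _ ?_
      (Submodule.smul_mem _ _ ?_))
    · exact resMode_mem_OgSubmodule hg hr hu hk _ 0 (m := i) (Nat.zero_le _) (by simp) rfl
    · refine resMode_mem_OgSubmodule hg hs hw hj _ 1 (m := i + 1) (by omega) (by simp) ?_
      rw [hδ]; push_cast; ring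
  · obtain ⟨N, hN⟩ := A.exists_mode_eq_zero (-1 - twistDelta r) u w
    rw [A.resMode_eq_sum hN, map_sum, LinearMap.sum_apply]
    refine Submodule.sum_mem _ fun i _ => ?_
    have h1 : A.Y u (-1 - twistDelta r + i) w ∈ twistEigenspace T g ((r + s) % T) := by
      rw [twistEigenspace_mod hT]
      exact A.mode_mem_twistEigenspace hg hu hw _
    rw [map_smul, LinearMap.smul_apply, A.star_apply_of_ne_zero hT (Nat.mod_lt _ hT) hrs h1,
      smul_zero]
    exact Submodule.zero_mem _

/-- In the iterate formula with `l = -1`, the first half of the term `i = 0` is `a *_g (b *_g c)`;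
everything else carries `z ^ (-2)` or a lower power. -/
theorem star_assoc_sub_mem_OgSubmodule (hg : A.IsAutomorphism g) (hT : 0 < T) {k j : ℤ} {a b : V}
    (ha : a ∈ twistEigenspace T g 0) (hk : a ∈ A.weightSpace k) (hb : b ∈ twistEigenspace T g 0)
    (hj : b ∈ A.weightSpace j) (c : V) :
    A.star T g (A.star T g a b) c - A.star T g a (A.star T g b c) ∈ OgSubmodule A T g := by
  rw [A.star_apply_zero hT ha hk, A.star_apply_zero hT ha hk, A.star_apply_zero hT hb hj]
  obtain ⟨N, hN⟩ := star_resMode_eq_sum hg hT ha hk hb hj (by simp) k (-1) (β := j)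
    (by push_cast; ring) c
  rw [hN (N + 1) (by omega), sum_range_succ', add_sub_assoc]
  have hδ : twistDelta 0 = 1 := rfl
  refine Submodule.add_mem _ (Submodule.sum_mem _ fun i _ => Submodule.smul_mem _ _
    (Submodule.sub_mem _ ?_ (Submodule.smul_mem _ _ ?_))) ?_
  · refine resMode_mem_OgSubmodule hg hT ha hk _ 0 (m := i) (Nat.zero_le _)
      (by simp [circExp_zero]) ?_
    rw [hδ]; push_cast; ring
  · refine resMode_mem_OgSubmodule hg hT hb hj _ 0 (m := i + 1) (Nat.zero_le _)
      (by simp [circExp_zero]) ?_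
    rw [hδ]
  · rw [binomC_zero_right, pow_zero, mul_one, one_smul, Nat.cast_zero, sub_zero, add_zero,
      sub_zero, sub_sub_cancel_left]
    exact Submodule.neg_mem _ (Submodule.smul_mem _ _ (resMode_mem_OgSubmodule hg hT hb hj _ 0
      (m := 0) le_rfl (by simp [circExp_zero]) (by rw [hδ]; simp)))

/-- The bilinear map on `A_g(V)` induced by `*_g`. -/
def starQuot (hg : A.IsAutomorphism g) (hT : 0 < T) (hord : orderOf g = T) :
    AgSpace A T g →ₗ[ℂ] AgSpace A T g →ₗ[ℂ] AgSpace A T g :=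
  (OgSubmodule A T g).liftQ
    ((OgSubmodule A T g).mapQLinear (OgSubmodule A T g) ∘ₗ
      (A.star T g).codRestrict ((OgSubmodule A T g).compatibleMaps (OgSubmodule A T g))
        fun a _ hx => star_mem_OgSubmodule_left hg hT hord a hx)
    fun _ hx => by
      rw [LinearMap.mem_ker]
      ext c
      exact (Submodule.Quotient.mk_eq_zero _).2 (star_mem_OgSubmodule_right hg hT hord hx c)

theorem starQuot_mk (hg : A.IsAutomorphism g) (hT : 0 < T) (hord : orderOf g = T) (u v : V) :
    starQuot hg hT hord (Submodule.Quotient.mk u) (Submodule.Quotient.mk v) =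
      Submodule.Quotient.mk (A.star T g u v) := rfl

/-- The algebra `A_g(V)`. -/
def zhuAlgebra (hg : A.IsAutomorphism g) (hT : 0 < T) (hord : orderOf g = T) : AgAlgebra A T g where
  mul := starQuot hg hT hord
  mul_mk r k u v hr hu hk := by rw [starQuot_mk, A.star_eq_starProd hT hr hu hk]
  mul_assoc a b c := by
    obtain ⟨a, rfl⟩ := Submodule.Quotient.mk_surjective _ a
    obtain ⟨b, rfl⟩ := Submodule.Quotient.mk_surjective _ b
    obtain ⟨c, rfl⟩ := Submodule.Quotient.mk_surjective _ c
    simp only [starQuot_mk]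
    rw [Submodule.Quotient.eq]
    refine A.mem_of_homogeneous hg hT hord (N := (OgSubmodule A T g).comap
      ((A.star T g).flip c ∘ₗ (A.star T g).flip b - (A.star T g).flip (A.star T g b c))) ?_ a
    intro r hr k a ha hk
    refine A.mem_of_homogeneous hg hT hord (N := (OgSubmodule A T g).comap
      ((A.star T g).flip c ∘ₗ A.star T g a - A.star T g a ∘ₗ (A.star T g).flip c)) ?_ b
    intro s hs j b hb hj
    change A.star T g (A.star T g a b) c - A.star T g a (A.star T g b c) ∈ OgSubmodule A T g
    rcases eq_or_ne r 0 with rfl | hr0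
    · rcases eq_or_ne s 0 with rfl | hs0
      · exact star_assoc_sub_mem_OgSubmodule hg hT ha hk hb hj c
      -- Here `b *_g c = 0`, while `b` lies in `O_g(V)`, and hence so does `(a *_g b) *_g c`.
      · rw [A.star_apply_of_ne_zero hT hs hs0 hb, map_zero, sub_zero]
        exact star_mem_OgSubmodule_right hg hT hord (star_mem_OgSubmodule_left hg hT hord a
          (mem_OgSubmodule_of_ne_zero hs hs0 hb hj)) c
    · rw [A.star_apply_of_ne_zero hT hr hr0 ha, A.star_apply_of_ne_zero hT hr hr0 ha, map_zero,
        LinearMap.zero_apply, sub_zero]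
      exact Submodule.zero_mem _
  vac_mul a := by
    obtain ⟨a, rfl⟩ := Submodule.Quotient.mk_surjective _ a
    rw [starQuot_mk, A.star_apply_zero hT (A.vac_mem_twistEigenspace hg T) A.vac_mem_weightSpace,
      A.resMode_eq_sum (N := 1) fun i hi => by rw [A.vacuum, if_neg (by omega)]; rfl,
      sum_range_one, binomC_zero_right, one_smul, A.vacuum, if_pos (by simp)]
    rfl
  mul_vac a := by
    obtain ⟨a, rfl⟩ := Submodule.Quotient.mk_surjective _ a
    rw [starQuot_mk, Submodule.Quotient.eq]
    refine A.mem_of_homogeneous hg hT hord (N := (OgSubmodule A T g).comap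
      ((A.star T g).flip A.vac - LinearMap.id)) ?_ a
    intro r hr k a ha hk
    change A.star T g a A.vac - a ∈ OgSubmodule A T g
    rcases eq_or_ne r 0 with rfl | hr0
    · rw [A.star_apply_zero hT ha hk, A.resMode_eq_sum (N := 1) fun i hi =>
        A.creation_regular _ _ (by omega), sum_range_one, binomC_zero_right, one_smul,
        Nat.cast_zero, add_zero, A.creation, sub_self]
      exact Submodule.zero_mem _
    · rw [A.star_apply_of_ne_zero hT hr hr0 ha, zero_sub]
      exact Submodule.neg_mem _ (mem_OgSubmodule_of_ne_zero hr hr0 ha hk)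

end VertexOperatorAlgebra

/-! ### Zero modes on `Ω(M)` and cyclic submodules -/

namespace WeakTwistedModule

variable {V : Type*} [AddCommGroup V] [Module ℂ V] {A : VertexOperatorAlgebra V} {T : ℕ}
  {g : V ≃ₗ[ℂ] V} {M : Type*} [AddCommGroup M] [Module ℂ M] (W : WeakTwistedModule A T g M)

/-- The linear map `v ↦ v_q y`. -/
def modeAt (q : ℚ) (y : M) : V →ₗ[ℂ] M :=
  LinearMap.applyₗ y ∘ₗ LinearMap.proj (R := ℂ) (φ := fun _ : ℚ => Module.End ℂ M) q ∘ₗ W.Y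

/-- The linear map `o` with `o(v) = v_{wt v - 1}` for homogeneous `v`. -/
def zeroMode : V →ₗ[ℂ] Module.End ℂ M :=
  A.weightwise fun k =>
    LinearMap.proj (R := ℂ) (φ := fun _ : ℚ => Module.End ℂ M) ((k : ℚ) - 1) ∘ₗ W.Y

theorem zeroMode_apply {k : ℤ} {u : V} (hu : u ∈ A.weightSpace k) :
    W.zeroMode u = W.Y u ((k : ℚ) - 1) := by
  rw [zeroMode, A.weightwise_apply _ hu]; rfl

/-- The index `wt u - 1` is an integer, whereas the modes of `u` sit in `r / T + ℤ` with `0 < r / T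
< 1`. -/
theorem zeroMode_of_ne_zero {r : ℕ} (hr : r < T) (h0 : r ≠ 0) {k : ℤ} {u : V}
    (hu : u ∈ twistEigenspace T g r) (hk : u ∈ A.weightSpace k) : W.zeroMode u = 0 := by
  rw [W.zeroMode_apply hk]
  refine W.mode_support r hr u hu _ ?_
  rintro ⟨j, hj⟩
  have hT0 : (0 : ℚ) < T := by exact_mod_cast (by omega : 0 < T)
  have h1 : (r : ℚ) / T < 1 := by rw [div_lt_one hT0]; exact_mod_cast hr
  have h2 : 0 < (r : ℚ) / T := by
    have : (0 : ℚ) < r := by exact_mod_cast Nat.pos_of_ne_zero h0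
    positivity
  have h3 : (r : ℚ) / T = ((k - 1 - j : ℤ) : ℚ) := by push_cast; linarith
  rw [h3] at h1 h2
  have h4 : k - 1 - j < 1 := by exact_mod_cast h1
  have h5 : 0 < k - 1 - j := by exact_mod_cast h2
  omega

theorem zeroMode_vac : W.zeroMode A.vac = 1 := by
  rw [W.zeroMode_apply A.vac_mem_weightSpace, W.vacuum, if_pos (by simp)]

/-- The zero mode of a residue is one side of the twisted Jacobi identity. -/
theorem zeroMode_resMode {k j : ℤ} {u v : V} (hk : u ∈ A.weightSpace k)
    (hj : v ∈ A.weightSpace j) {r : ℕ} (hr : r < T) (hu : u ∈ twistEigenspace T g r) {m : ℚ}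
    (hm : ∃ i : ℤ, m = (r : ℚ) / (T : ℚ) + i) {l : ℤ} {n : ℚ} (hn : n = k + j - l - 2 - m) (w : M) :
    W.zeroMode (A.resMode m l u v) w =
      ∑ᶠ i : ℕ, ((-1 : ℂ) ^ i * ((Ring.choose l i : ℤ) : ℂ)) •
        (W.Y u (l + m - i) (W.Y v (n + i) w) -
          (-1 : ℂ) ^ l • W.Y v (l + n - i) (W.Y u (m + i) w)) := by
  obtain ⟨N, hN⟩ := A.exists_mode_eq_zero l u v
  rw [W.jacobi r hr u hu v w l m n hm, finsum_eq_sum_range (N := N) fun i hi => by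
    rw [hN i hi]; simp, A.resMode_eq_sum hN, map_sum, LinearMap.sum_apply]
  refine sum_congr rfl fun i _ => ?_
  rw [map_smul, LinearMap.smul_apply, W.zeroMode_apply (A.mode_mem_weightSpace hk hj _), hn]
  rw [show ((k + j - (l + i) - 1 : ℤ) : ℚ) - 1 = m + (k + j - l - 2 - m) - i by push_cast; ring]
  rfl

/-- In the Jacobi sum the innermost modes have degrees `r / T - 1 - i` for `v` and `-δ_r - r / T -
i` for `u`. Both are negative, so each term kills `w`. -/
theorem zeroMode_circ_apply {w : M} (hw : w ∈ W.Omega) {k j : ℤ} {u v : V}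
    (hk : u ∈ A.weightSpace k) (hj : v ∈ A.weightSpace j) {r : ℕ} (hr : r < T)
    (hu : u ∈ twistEigenspace T g r) :
    W.zeroMode (A.resMode (circExp T r k) (-1 - twistDelta r) u v) w = 0 := by
  have hT0 : (0 : ℚ) < T := by exact_mod_cast (by omega : 0 < T)
  have h1 : (r : ℚ) / T < 1 := by rw [div_lt_one hT0]; exact_mod_cast hr
  have h2 : 0 < (twistDelta r : ℚ) + (r : ℚ) / T := by
    rcases Nat.eq_zero_or_pos r with rfl | h0
    · simp [twistDelta]
    · have : (0 : ℚ) < r := by exact_mod_cast h0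
      have := twistDelta_nonneg r
      positivity
  rw [W.zeroMode_resMode hk hj hr hu ⟨k - 1 + twistDelta r, by
    simp only [circExp]; push_cast; ring⟩ rfl]
  refine finsum_eq_zero_of_forall_eq_zero fun i => ?_
  have hi : (0 : ℚ) ≤ i := Nat.cast_nonneg i
  rw [hw j v hj _ (by simp only [circExp]; push_cast; linarith),
    hw k u hk _ (by simp only [circExp]; linarith)]
  simp

/-- With `l = -1` the innermost modes have degree `-i` for `v` and `-1 - i` for `u`, so only `o(u)
o(v) w` remains, from `i = 0`. -/
theorem zeroMode_star_apply (hT : 0 < T) {w : M} (hw : w ∈ W.Omega) {k j : ℤ} {u v : V}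
    (hk : u ∈ A.weightSpace k) (hj : v ∈ A.weightSpace j) (hu : u ∈ twistEigenspace T g 0) :
    W.zeroMode (A.star T g u v) w = W.zeroMode u (W.zeroMode v w) := by
  rw [A.star_apply_zero hT hu hk, W.zeroMode_resMode hk hj hT hu ⟨k, by simp⟩ (n := j - 1)
    (by push_cast; ring), finsum_eq_single _ 0]
  · rw [W.zeroMode_apply hk, W.zeroMode_apply hj, hw k u hk _ (by simp)]
    simp only [Ring.choose_zero_right, pow_zero, Int.cast_one, mul_one, one_smul, map_zero,
      smul_zero, sub_zero, Nat.cast_zero, add_zero]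
    rw [show ((-1 : ℤ) : ℚ) + k = k - 1 by push_cast; ring]
  · intro i hi
    have hi : (1 : ℚ) ≤ i := by exact_mod_cast Nat.pos_of_ne_zero hi
    rw [hw j v hj _ (by linarith), hw k u hk _ (by linarith)]
    simp

theorem zeroMode_apply_of_mem_OgSubmodule (hg : A.IsAutomorphism g) (hT : 0 < T)
    (hord : orderOf g = T) {x : V} (hx : x ∈ OgSubmodule A T g) {w : M} (hw : w ∈ W.Omega) :
    W.zeroMode x w = 0 :=
  (Submodule.mem_bot ℂ).1 <| VertexOperatorAlgebra.apply_mem_of_mem_OgSubmodule hg hT hord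
    (LinearMap.applyₗ w ∘ₗ W.zeroMode) (N := ⊥) (fun _ hr _ _ _ _ _ _ hu hk _ hj =>
      (Submodule.mem_bot ℂ).2 (W.zeroMode_circ_apply hw hk hj hr hu)) hx

theorem zeroMode_star (hg : A.IsAutomorphism g) (hT : 0 < T) (hord : orderOf g = T) (u v : V)
    {w : M} (hw : w ∈ W.Omega) :
    W.zeroMode (A.star T g u v) w = W.zeroMode u (W.zeroMode v w) := by
  rw [← sub_eq_zero, ← Submodule.mem_bot ℂ]
  refine A.mem_of_homogeneous hg hT hord (N := (⊥ : Submodule ℂ M).comap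
    (LinearMap.applyₗ w ∘ₗ W.zeroMode ∘ₗ (A.star T g).flip v -
      LinearMap.applyₗ (W.zeroMode v w) ∘ₗ W.zeroMode)) (fun r hr k u hu hk => ?_) u
  refine A.mem_of_weightSpace_le (N := (⊥ : Submodule ℂ M).comap
    (LinearMap.applyₗ w ∘ₗ W.zeroMode ∘ₗ A.star T g u -
      W.zeroMode u ∘ₗ LinearMap.applyₗ w ∘ₗ W.zeroMode)) (fun j v hj => ?_) v
  rw [Submodule.mem_comap, Submodule.mem_bot]
  change W.zeroMode (A.star T g u v) w - W.zeroMode u (W.zeroMode v w) = 0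
  rcases eq_or_ne r 0 with rfl | hr0
  · rw [W.zeroMode_star_apply hT hw hk hj hu, sub_self]
  · rw [A.star_apply_of_ne_zero hT hr hr0 hu, W.zeroMode_of_ne_zero hr hr0 hu hk]
    simp

/-- The span of all `v_t w`. -/
def cyclicSpan (w : M) : Submodule ℂ M := Submodule.span ℂ {y | ∃ (v : V) (t : ℚ), y = W.Y v t w}

theorem mode_mem_cyclicSpan (v : V) (t : ℚ) (w : M) : W.Y v t w ∈ W.cyclicSpan w :=
  Submodule.subset_span ⟨v, t, rfl⟩

theorem self_mem_cyclicSpan (w : M) : w ∈ W.cyclicSpan w := by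
  have := W.mode_mem_cyclicSpan A.vac (-1) w
  rwa [W.vacuum, if_pos rfl] at this

/-- The Jacobi identity rewrites `u_q v_t w` through single modes applied to `w` and products
`u_{q-i} v_{t+i} w` with `i > 0`. Since `v_t w = 0` for large `t`, induction on the distance of `t`
from that bound ends. -/
theorem mode_mode_mem_cyclicSpan {r : ℕ} (hr : r < T) {u : V} (hu : u ∈ twistEigenspace T g r)
    (v : V) (w : M) (q t : ℚ) : W.Y u q (W.Y v t w) ∈ W.cyclicSpan w := by
  by_cases hq : ∃ j : ℤ, q = (r : ℚ) / T + j
  swap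
  · rw [W.mode_support r hr u hu q hq]
    exact Submodule.zero_mem _
  obtain ⟨Nu, hNu⟩ := W.truncation u w
  obtain ⟨Nv, hNv⟩ := W.truncation v w
  obtain ⟨j₀, hj₀⟩ := exists_int_gt (Nu - (r : ℚ) / T)
  suffices h : ∀ d : ℕ, ∀ t : ℚ, Nv ≤ t + d → ∀ j : ℤ,
      W.Y u ((r : ℚ) / T + j) (W.Y v t w) ∈ W.cyclicSpan w by
    obtain ⟨j, rfl⟩ := hq
    obtain ⟨d, hd⟩ := exists_nat_gt (Nv - t)
    exact h d t (by linarith) j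
  intro d
  induction d with
  | zero =>
    intro t ht j
    rw [hNv t (by simpa using ht), map_zero]
    exact Submodule.zero_mem _
  | succ d ih =>
    intro t ht j
    push_cast at ht
    obtain ⟨N, hN⟩ := A.exists_mode_eq_zero (j - j₀) u v
    have hu0 : ∀ i : ℕ, W.Y u ((r : ℚ) / T + j₀ + i) w = 0 := fun i =>
      hNu _ (by have : (0 : ℚ) ≤ i := Nat.cast_nonneg i
                linarith)
    -- The index `r / T + j₀` is past the truncation bound of `u` on `w`, so the terms with `u`
    -- innermost vanish; `l = j - j₀` puts `u_q v_t w` at `i = 0`.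
    have h := W.jacobi r hr u hu v w (j - j₀) ((r : ℚ) / T + j₀) t ⟨j₀, rfl⟩
    rw [finsum_eq_sum_range (N := d + 1) fun i hi => by
        have : (d : ℚ) + 1 ≤ i := by exact_mod_cast hi
        rw [hu0, hNv _ (by linarith)]; simp,
      finsum_eq_sum_range (N := N) fun i hi => by rw [hN i hi]; simp, sum_range_succ',
      ← eq_sub_iff_add_eq'] at h
    have hu00 := hu0 0
    rw [Nat.cast_zero, add_zero] at hu00
    simp only [hu0, hu00, map_zero, smul_zero, sub_zero, Ring.choose_zero_right, pow_zero, Int.cast_one,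
      mul_one, one_smul, Nat.cast_zero, add_zero] at h
    rw [show ((j - j₀ : ℤ) : ℚ) + ((r : ℚ) / T + j₀) = (r : ℚ) / T + j by push_cast; ring] at h
    rw [h]
    refine Submodule.sub_mem _ (Submodule.sum_mem _ fun i _ => Submodule.smul_mem _ _
      (W.mode_mem_cyclicSpan _ _ _)) (Submodule.sum_mem _ fun i _ => Submodule.smul_mem _ _ ?_)
    have := ih (t + (i + 1 : ℕ)) (by
      have : (0 : ℚ) ≤ i := Nat.cast_nonneg i
      push_cast
      linarith) (j - (i + 1 : ℕ))
    rwa [show (r : ℚ) / T + ((j - (i + 1 : ℕ) : ℤ) : ℚ) = (r : ℚ) / T + j - (i + 1 : ℕ) by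
      push_cast; ring] at this

theorem mode_mem_cyclicSpan_of_mem (hg : A.IsAutomorphism g) (hT : 0 < T) (hord : orderOf g = T)
    (u : V) (q : ℚ) {w y : M} (hy : y ∈ W.cyclicSpan w) : W.Y u q y ∈ W.cyclicSpan w := by
  refine A.mem_of_homogeneous hg hT hord (N := (W.cyclicSpan w).comap (W.modeAt q y))
    (fun r hr k u hu _ => ?_) u
  have : W.cyclicSpan w ≤ (W.cyclicSpan w).comap (W.Y u q) := by
    refine Submodule.span_le.2 ?_
    rintro _ ⟨v, t, rfl⟩
    exact W.mode_mode_mem_cyclicSpan hr hu v w q t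
  exact this hy

/-- A linear map sends `cyclicSpan w` into `N` if it does so on the `v_t w`, `v` homogeneous. -/
theorem apply_mem_of_mem_cyclicSpan {X : Type*} [AddCommGroup X] [Module ℂ X] (f : M →ₗ[ℂ] X)
    {N : Submodule ℂ X} {w : M} (h : ∀ k, ∀ v ∈ A.weightSpace k, ∀ t, f (W.Y v t w) ∈ N) {y : M}
    (hy : y ∈ W.cyclicSpan w) : f y ∈ N := by
  have : W.cyclicSpan w ≤ N.comap f := by
    refine Submodule.span_le.2 ?_
    rintro _ ⟨v, t, rfl⟩
    exact A.mem_of_weightSpace_le (N := (N.comap f).comap (W.modeAt t w))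
      (fun k v hv => h k v hv t) v
  exact this hy

end WeakTwistedModule

/-! ### The grading, lowest weight vectors and simplicity -/

namespace AdmissibleTwistedModule

variable {V : Type*} [AddCommGroup V] [Module ℂ V] {A : VertexOperatorAlgebra V} {T : ℕ}
  {g : V ≃ₗ[ℂ] V} {M : Type*} [AddCommGroup M] [Module ℂ M] (W : AdmissibleTwistedModule A T g M)

theorem gr_eq_bot_of_neg {q : ℚ} (hq : q < 0) : W.gr q = ⊥ := by
  refine W.gr_support q ?_
  rintro ⟨j, rfl⟩
  exact absurd hq (not_lt.2 (by positivity))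

theorem bijective_coeLinearMap_gr : Function.Bijective (DirectSum.coeLinearMap W.gr) :=
  W.gr_internal

/-- The component of degree `q`. -/
def component (q : ℚ) : M →ₗ[ℂ] M :=
  (W.gr q).subtype ∘ₗ DirectSum.component ℂ ℚ (fun q => W.gr q) q ∘ₗ
    ((LinearEquiv.ofBijective (DirectSum.coeLinearMap W.gr)
      W.bijective_coeLinearMap_gr).symm : M →ₗ[ℂ] _)

theorem component_mem (q : ℚ) (x : M) : W.component q x ∈ W.gr q := Subtype.property _

theorem component_apply_of_mem {p : ℚ} {x : M} (hx : x ∈ W.gr p) (q : ℚ) :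
    W.component q x = if p = q then x else 0 := by
  have : (LinearEquiv.ofBijective (DirectSum.coeLinearMap W.gr) W.bijective_coeLinearMap_gr).symm x =
      DirectSum.lof ℂ ℚ (fun q => W.gr q) p ⟨x, hx⟩ := by
    rw [LinearEquiv.symm_apply_eq, LinearEquiv.ofBijective_apply, DirectSum.coeLinearMap_lof]
  rw [component, LinearMap.comp_apply, LinearMap.comp_apply, LinearEquiv.coe_coe, this]
  split_ifs with h
  · subst h
    rw [DirectSum.component.lof_self]
    rfl
  · rw [DirectSum.component.of, dif_neg h]
    rfl

theorem mem_of_gr_le {N : Submodule ℂ M} (h : ∀ q, W.gr q ≤ N) (x : M) : x ∈ N := by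
  have : (⊤ : Submodule ℂ M) ≤ N := by
    rw [← W.gr_internal.submodule_iSup_eq_top]
    exact iSup_le h
  exact this trivial

theorem mem_of_component_mem {N : Submodule ℂ M} {x : M} (h : ∀ q, W.component q x ∈ N) :
    x ∈ N := by
  classical
  set e := LinearEquiv.ofBijective (DirectSum.coeLinearMap W.gr) W.bijective_coeLinearMap_gr
  have h1 : x = DirectSum.coeLinearMap W.gr (e.symm x) := (e.apply_symm_apply x).symm
  rw [h1, DirectSum.coeLinearMap_eq_dfinsuppSum]
  exact Submodule.dfinsuppSum_mem _ _ _ fun q _ => h q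

theorem component_mode {k : ℤ} {v : V} (hv : v ∈ A.weightSpace k) (m q : ℚ) (x : M) :
    W.component (q + k - m - 1) (W.Y v m x) = W.Y v m (W.component q x) := by
  rw [← sub_eq_zero, ← Submodule.mem_bot ℂ]
  refine W.mem_of_gr_le (N := (⊥ : Submodule ℂ M).comap
    (W.component (q + k - m - 1) ∘ₗ W.Y v m - W.Y v m ∘ₗ W.component q)) (fun p x hx => ?_) x
  rw [Submodule.mem_comap, Submodule.mem_bot, LinearMap.sub_apply, LinearMap.comp_apply,
    LinearMap.comp_apply, W.component_apply_of_mem hx,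
    W.component_apply_of_mem (W.mode_gr k v hv m p x hx)]
  by_cases h : p = q
  · simp [h]
  · rw [if_neg h, if_neg (fun h' => h (by linarith)), map_zero, sub_zero]

/-- A homogeneous mode shifts degrees by a constant, so it kills a vector only if it kills each
component. -/
theorem component_mem_Omega {w : M} (hw : w ∈ W.Omega) (q : ℚ) : W.component q w ∈ W.Omega := by
  intro k a ha m hm
  rw [← W.component_mode ha, hw k a ha m hm, map_zero]

theorem gr_zero_le_Omega : W.gr 0 ≤ W.Omega := by
  intro w hw k a ha m hm
  have := W.mode_gr k a ha m 0 w hw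
  rwa [W.gr_eq_bot_of_neg (by linarith), Submodule.mem_bot] at this

theorem isGradedSubmodule_cyclicSpan (hg : A.IsAutomorphism g) (hT : 0 < T) (hord : orderOf g = T)
    {n : ℚ} {w : M} (hw : w ∈ W.gr n) : W.IsGradedSubmodule (W.cyclicSpan w) where
  mode_mem u q _ hy := W.mode_mem_cyclicSpan_of_mem hg hT hord u q hy
  graded := by
    refine le_antisymm (fun y hy => ?_) (iSup_le fun q => inf_le_left)
    refine W.apply_mem_of_mem_cyclicSpan LinearMap.id (fun k v hv t => ?_) hy
    exact Submodule.mem_iSup_of_mem (n + k - t - 1)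
      ⟨W.mode_mem_cyclicSpan v t w, W.mode_gr k v hv t n w hw⟩

variable {W}

theorem IsSimple.mem_cyclicSpan (hW : W.IsSimple) (hg : A.IsAutomorphism g) (hT : 0 < T)
    (hord : orderOf g = T) {n : ℚ} {w : M} (hw : w ∈ W.gr n) (h0 : w ≠ 0) (y : M) :
    y ∈ W.cyclicSpan w := by
  rcases hW.2 _ (W.isGradedSubmodule_cyclicSpan hg hT hord hw) with h | h
  · have := W.self_mem_cyclicSpan w
    rw [h, Submodule.mem_bot] at this
    exact (h0 this).elim
  · rw [h]; trivial

/-- A nonzero component in degree `q > 0` would generate `M` using modes of nonnegative degree only,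
leaving nothing in degree zero. -/
theorem IsSimple.Omega_eq_gr_zero (hW : W.IsSimple) (hg : A.IsAutomorphism g) (hT : 0 < T)
    (hord : orderOf g = T) (hM0 : W.gr 0 ≠ ⊥) : W.Omega = W.gr 0 := by
  refine le_antisymm (fun w hw => W.mem_of_component_mem fun q => ?_) W.gr_zero_le_Omega
  rcases eq_or_ne q 0 with rfl | hq
  · exact W.component_mem 0 w
  suffices h : W.component q w = 0 by rw [h]; exact Submodule.zero_mem _
  by_contra h0
  have hx := W.component_mem q w
  have hΩ := W.component_mem_Omega hw q
  have hq0 : 0 < q := by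
    refine lt_of_le_of_ne (not_lt.1 fun hneg => h0 ?_) hq.symm
    rwa [W.gr_eq_bot_of_neg hneg, Submodule.mem_bot] at hx
  refine hM0 ((Submodule.eq_bot_iff _).2 fun y hy => ?_)
  have hy0 : W.component 0 y = y := by rw [W.component_apply_of_mem hy, if_pos rfl]
  rw [← hy0, ← Submodule.mem_bot ℂ]
  refine W.apply_mem_of_mem_cyclicSpan (W.component 0) (fun k v hv t => ?_)
    (hW.mem_cyclicSpan hg hT hord hx h0 y)
  rw [Submodule.mem_bot]
  by_cases hneg : (k : ℚ) - t - 1 < 0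
  · rw [hΩ k v hv t hneg, map_zero]
  · rw [W.component_apply_of_mem (W.mode_gr k v hv t q _ hx), if_neg]
    intro h
    linarith

/-- Projecting `M`, the span of the `v_t w`, to degree zero discards all modes but those with `t =
wt v - 1`. -/
theorem IsSimple.exists_zeroMode_apply_eq (hW : W.IsSimple) (hg : A.IsAutomorphism g) (hT : 0 < T)
    (hord : orderOf g = T) {w y : M} (hw : w ∈ W.gr 0) (h0 : w ≠ 0) (hy : y ∈ W.gr 0) :
    ∃ v, W.zeroMode v w = y := by
  have hy0 : W.component 0 y = y := by rw [W.component_apply_of_mem hy, if_pos rfl]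
  have h : W.component 0 y ∈ LinearMap.range (LinearMap.applyₗ w ∘ₗ W.zeroMode) := by
    refine W.apply_mem_of_mem_cyclicSpan (W.component 0) (fun k v hv t => ?_)
      (hW.mem_cyclicSpan hg hT hord hw h0 y)
    rw [W.component_apply_of_mem (W.mode_gr k v hv t 0 _ hw)]
    split_ifs with ht
    · refine ⟨v, ?_⟩
      rw [LinearMap.comp_apply, LinearMap.applyₗ_apply_apply, W.zeroMode_apply hv,
        show (k : ℚ) - 1 = t by linarith]
    · exact Submodule.zero_mem _
  rwa [hy0] at h

variable (W)

theorem zeroMode_mem_gr {w : M} {n : ℚ} (hw : w ∈ W.gr n) (v : V) : W.zeroMode v w ∈ W.gr n := by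
  refine A.mem_of_weightSpace_le
    (N := (W.gr n).comap (LinearMap.applyₗ w ∘ₗ W.zeroMode)) (fun k v hv => ?_) v
  rw [Submodule.mem_comap, LinearMap.comp_apply, LinearMap.applyₗ_apply_apply,
    W.zeroMode_apply hv]
  have := W.mode_gr k v hv (k - 1) n w hw
  rwa [show n + k - ((k : ℚ) - 1) - 1 = n by ring] at this

end AdmissibleTwistedModule

/-! ### The representation of `A_g(V)` on `Ω(M)` -/

namespace WeakTwistedModule

variable {V : Type*} [AddCommGroup V] [Module ℂ V] {A : VertexOperatorAlgebra V} {T : ℕ}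
  {g : V ≃ₗ[ℂ] V} {M : Type*} [AddCommGroup M] [Module ℂ M] (W : WeakTwistedModule A T g M)

/-- The action of `V` on `Ω(M)` by zero modes, if these preserve `Ω(M)`. -/
def omegaAction (h : ∀ v, ∀ w ∈ W.Omega, W.zeroMode v w ∈ W.Omega) :
    V →ₗ[ℂ] Module.End ℂ W.Omega where
  toFun v := (W.zeroMode v).restrict (h v)
  map_add' u v := by ext w; simp
  map_smul' c v := by ext w; simp

/-- The representation of `A_g(V)` on `Ω(M)`. -/
def omegaRep (hg : A.IsAutomorphism g) (hT : 0 < T) (hord : orderOf g = T)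
    (h : ∀ v, ∀ w ∈ W.Omega, W.zeroMode v w ∈ W.Omega) :
    (VertexOperatorAlgebra.zhuAlgebra hg hT hord).Carrier →ₐ[ℂ] Module.End ℂ W.Omega :=
  AlgHom.ofLinearMap
    ((OgSubmodule A T g).liftQ (W.omegaAction h) fun x hx => by
      rw [LinearMap.mem_ker]
      ext w
      exact W.zeroMode_apply_of_mem_OgSubmodule hg hT hord hx w.2)
    (by
      ext w
      change W.zeroMode A.vac w = w
      rw [W.zeroMode_vac]
      rfl)
    (by
      intro a b
      obtain ⟨a, rfl⟩ := Submodule.Quotient.mk_surjective _ a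
      obtain ⟨b, rfl⟩ := Submodule.Quotient.mk_surjective _ b
      ext w
      exact W.zeroMode_star hg hT hord a b w.2)

end WeakTwistedModule

theorem proposition5 {V : Type*} [AddCommGroup V] [Module ℂ V] (A : VertexOperatorAlgebra V)
    (g : V ≃ₗ[ℂ] V) (hg : A.IsAutomorphism g) (T : ℕ) (hT : 0 < T) (hord : orderOf g = T)
    {M : Type*} [AddCommGroup M] [Module ℂ M] (W : AdmissibleTwistedModule A T g M)
    (hsimple : W.IsSimple) (hM0 : W.gr 0 ≠ ⊥) :
    W.Omega = W.gr 0 ∧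
    ∃ (S : AgAlgebra A T g) (_ : Module S.Carrier W.Omega),
      IsScalarTower ℂ S.Carrier W.Omega ∧
      (∀ (k : ℤ) (a : V), a ∈ twistEigenspace T g 0 → a ∈ A.weightSpace k → ∀ w : W.Omega,
        ((S.toClass a • w : W.Omega) : M) = W.Y a ((k : ℚ) - 1) (w : M)) ∧
      IsSimpleModule S.Carrier W.Omega := by
  have hΩ := hsimple.Omega_eq_gr_zero hg hT hord hM0
  have hmem : ∀ v, ∀ w ∈ W.Omega, W.zeroMode v w ∈ W.Omega := fun v w hw => by
    rw [hΩ] at hw ⊢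
    exact W.zeroMode_mem_gr hw v
  let S := VertexOperatorAlgebra.zhuAlgebra hg hT hord
  let ρ : S.Carrier →ₐ[ℂ] Module.End ℂ W.Omega := W.omegaRep hg hT hord hmem
  let inst : Module S.Carrier W.Omega := Module.compHom W.Omega ρ.toRingHom
  have hρ : ∀ (v : V) (w : W.Omega), ((S.toClass v • w : W.Omega) : M) = W.zeroMode v w :=
    fun _ _ => rfl
  refine ⟨hΩ, S, inst, ⟨fun c s w => ?_⟩, fun k a _ hk w => ?_, ?_⟩
  · exact congrArg (fun f : Module.End ℂ W.Omega => f w) (map_smul ρ c s)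
  · rw [hρ, W.zeroMode_apply hk]
  -- Simplicity is checked as: the module is nonzero and each nonzero vector generates it.
  · rw [isSimpleModule_iff_toSpanSingleton_surjective]
    refine ⟨?_, fun w hw y => ?_⟩
    · rw [Submodule.nontrivial_iff_ne_bot, hΩ]
      exact hM0
    · obtain ⟨v, hv⟩ := hsimple.exists_zeroMode_apply_eq hg hT hord (hΩ.le w.2)
        (fun h => hw (Subtype.ext h)) (hΩ.le y.2)
      exact ⟨S.toClass v, Subtype.ext hv⟩
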